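/- For $Q\in\{\mathbb R,\ \mathbb R_+\times\mathbb R,\ \mathbb R_+\times\mathbb R\times\mathbb R\}$, where $\mathbb R_+=[0,\infty)$, let $C^\infty(Q)$ be the space of smooth real functions on $Q$ (one-sidedly at the boundary) with the topology of uniform convergence on compact subsets of $Q$ of the derivatives of every order. Functions on $S^1$ are identified with functions of $\eta\in\mathbb R$ of period $1$. Let $C^\infty(S^1)$, $F=C^\infty(\mathbb R_+\times S^1)$ and $E_A=C^\infty(\mathbb R_+\times S^1\times\mathbb R)$ be the subspaces, with the subspace topology, of those functions $y_0(\eta)$, $y(t,\eta)$, $\varphi(t,\eta,\xi)$ that have period $1$ in $\eta$. Let $E_1$ be the subspace of $E_A$, with the subspace topology, of all $\varphi$ such that for every $T\ge 0$ there is $M<\infty$ with $\varphi(t,\eta,\xi)=0$ whenever $0\le t\le T$ and $|\xi|\ge M$. Let $E=C^\infty(S^1)\times E_1$ with the product topology. Let $\Sigma$, the solution relation of the initial value problem $y_t+y_\eta=\varphi(t,\eta,y)$, $y(0,\cdot)=y_0$ on the half-cylinder, be the set of all $(y_0,\varphi,y)$ such that $(y_0,\varphi)\in E$, $y:\mathbb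 R_+\times\mathbb R\to\mathbb R$ is of class $C^1$ with $y(t,\eta+1)=y(t,\eta)$, and $$y(t,\eta)=y_0(\eta-t)+\int_0^t\varphi\bigl(\tau,\eta-t+\tau,\,y(\tau,\eta-t+\tau)\bigr)\,d\tau\qquad(t\ge 0,\ \eta\in\mathbb R).$$ A map $f:\Omega\to G$ on a subset $\Omega$ of a Hausdorff locally convex space $X$, with values in a Hausdorff locally convex space $G$, is called Keller-smooth (of class $C^\infty_\Pi$) if $\Omega$ is open, for every $l\in\mathbb N_0$ and $x\in\Omega$ the iterated directional derivatives $d^lf(x)(u_1,\dots,u_l)$ exist and form a continuous $l$-linear map $X^l\to G$, and for all $l\in\mathbb N_0$, $x\in\Omega$ and every zero-neighbourhood $W$ in $G$ there is a zero-neighbourhood $U$ in $X$ such that for every $\varepsilon>0$ there is a zero-neighbourhood $V$ in $X$ with $\bigl(d^lf(x+v)-d^lf(x)\bigr)[U^l]\subseteq\varepsilon W$ for all $v\in V$. **Theorem 5.6.** The relation $\Sigma$ is defined on all of $E$: for every $(y_0,\varphi)\in E$ there is $y$ with $(y_0,\varphi,y)\in\Sigma$. Moreover, $\Sigma$ is (the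 graph of) a Keller-smooth map $E\to F$; that is, $y$ is unique, $y\in F=C^\infty(\mathbb R_+\times S^1)$, and the map $E\to F$, $(y_0,\varphi)\mapsto y$, is Keller-smooth. -/

import Mathlib

open scoped Topology Pointwise

/-! ### Keller smooth maps between locally convex spaces -/

section Keller

variable {E F : Type*}
  [AddCommGroup E] [Module ℝ E] [TopologicalSpace E] [IsTopologicalAddGroup E]
  [ContinuousSMul ℝ E] [LocallyConvexSpace ℝ E] [T2Space E]
  [AddCommGroup F] [Module ℝ F] [TopologicalSpace F] [IsTopologicalAddGroup F]
  [ContinuousSMul ℝ F] [LocallyConvexSpace ℝ F] [T2Space F]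

/-- A map `f : E ⊇ Ω → F` of Hausdorff locally convex spaces is smooth in the sense of Keller (of
class `C_Π^∞`): `Ω` is open, all iterated directional derivatives
`D l x u = d_{u_l} ⋯ d_{u_1} f (x)` exist on `Ω`, they are continuous and multilinear in `u`, and
each `D l` is continuous in `x` in the strong sense that for every `x ∈ Ω` and every
zero-neighbourhood `W` of `F` there is ONE zero-neighbourhood `U` of `E` such that for every
`ε > 0` one has `(D l (x + v) - D l x) [U ^ l] ⊆ ε W` for all sufficiently small `v`.

As `Ω` is open and `F` is Hausdorff, the values of `D` on `Ω` are determined by `f`. -/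
def KellerSmoothOn (f : E → F) (Ω : Set E) : Prop :=
  IsOpen Ω ∧
  ∃ D : ∀ l : ℕ, E → ContinuousMultilinearMap ℝ (fun _ : Fin l => E) F,
    (∀ x ∈ Ω, ∀ u : Fin 0 → E, D 0 x u = f x) ∧
    (∀ l : ℕ, ∀ x ∈ Ω, ∀ (u : Fin l → E) (h : E),
      Filter.Tendsto (fun t : ℝ => t⁻¹ • (D l (x + t • h) u - D l x u)) (𝓝[≠] 0)
        (𝓝 (D (l + 1) x (Fin.snoc (α := fun _ => E) u h)))) ∧
    (∀ l : ℕ, ∀ x ∈ Ω, ∀ W ∈ 𝓝 (0 : F), ∃ U ∈ 𝓝 (0 : E),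
      ∀ ε : ℝ, 0 < ε → ∃ V ∈ 𝓝 (0 : E), ∀ v ∈ V, ∀ u : Fin l → E, (∀ i, u i ∈ U) →
        D l (x + v) u - D l x u ∈ ε • W)

end Keller

/-! ### Spaces of smooth functions on a subset `Q` of a normed space -/

section FunctionSpaces

variable {V : Type*}

/-- Extension by zero of a function defined on `Q` only. It serves to write the values of such a
function at points of `Q`; the definitions below do not depend on the values outside `Q`. -/
noncomputable def extendZero {Q : Set V} (f : Q → ℝ) : V → ℝ :=
  Function.extend Subtype.val f 0

theorem extendZero_apply {Q : Set V} (f : Q → ℝ) (x : Q) : extendZero f x = f x :=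
  Subtype.val_injective.extend_apply f 0 x

theorem extendZero_of_notMem {Q : Set V} (f : Q → ℝ) {x : V} (hx : x ∉ Q) :
    extendZero f x = 0 :=
  Function.extend_apply' (f := Subtype.val) f 0 x (fun ⟨a, ha⟩ => hx (ha ▸ a.2))

theorem extendZero_add {Q : Set V} (f g : Q → ℝ) :
    extendZero (f + g) = extendZero f + extendZero g := by
  funext x
  by_cases hx : x ∈ Q
  · lift x to Q using hx
    simp [extendZero_apply]
  · simp [extendZero_of_notMem _ hx]

theorem extendZero_smul {Q : Set V} (c : ℝ) (f : Q → ℝ) :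
    extendZero (c • f) = c • extendZero f := by
  funext x
  by_cases hx : x ∈ Q
  · lift x to Q using hx
    simp [extendZero_apply]
  · simp [extendZero_of_notMem _ hx]

theorem extendZero_zero {Q : Set V} : extendZero (0 : Q → ℝ) = 0 := by
  simpa using extendZero_smul (0 : ℝ) (0 : Q → ℝ)

variable [NormedAddCommGroup V] [NormedSpace ℝ V]

/-- The functions `Q → ℝ` that are of class `C^n` on `Q` (one-sidedly at boundary points). -/
def contDiffSubmodule (n : ℕ∞) (Q : Set V) : Submodule ℝ (Q → ℝ) where
  carrier := {f | ContDiffOn ℝ n (extendZero f) Q}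
  add_mem' {f g} hf hg := by
    simp only [Set.mem_ofPred_eq, extendZero_add] at *
    exact hf.add hg
  zero_mem' := by
    simp only [Set.mem_ofPred_eq, extendZero_zero]
    exact contDiffOn_const
  smul_mem' c f hf := by
    simp only [Set.mem_ofPred_eq, extendZero_smul] at *
    exact contDiffOn_const.smul hf

/-- The space `C^∞(Q)` of smooth functions on `Q`. (A type of its own, because its topology is
not the one induced by the product topology of `Q → ℝ`.) -/
def SmoothSpace (Q : Set V) : Type _ := contDiffSubmodule ⊤ Q

noncomputable instance (Q : Set V) : AddCommGroup (SmoothSpace Q) :=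
  inferInstanceAs (AddCommGroup (contDiffSubmodule ⊤ Q))

noncomputable instance (Q : Set V) : Module ℝ (SmoothSpace Q) :=
  inferInstanceAs (Module ℝ (contDiffSubmodule ⊤ Q))

/-- The function underlying an element of `C^∞(Q)`. -/
def SmoothSpace.toFun {Q : Set V} (f : SmoothSpace Q) : Q → ℝ := Subtype.val f

/-- The function underlying an element of `C^∞(Q)`, extended by zero. -/
noncomputable def SmoothSpace.ext {Q : Set V} (f : SmoothSpace Q) : V → ℝ := extendZero f.toFun

theorem SmoothSpace.toFun_injective {Q : Set V} :
    Function.Injective (SmoothSpace.toFun : SmoothSpace Q → Q → ℝ) := Subtype.val_injective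

theorem SmoothSpace.contDiffOn_ext {Q : Set V} (f : SmoothSpace Q) :
    ContDiffOn ℝ ((⊤ : ℕ∞) : WithTop ℕ∞) f.ext Q := Subtype.property f

theorem SmoothSpace.ext_add {Q : Set V} (f g : SmoothSpace Q) : (f + g).ext = f.ext + g.ext :=
  extendZero_add f.toFun g.toFun

theorem SmoothSpace.ext_smul {Q : Set V} (c : ℝ) (f : SmoothSpace Q) :
    (c • f).ext = c • f.ext :=
  extendZero_smul c f.toFun

theorem SmoothSpace.ext_zero {Q : Set V} : (0 : SmoothSpace Q).ext = 0 :=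
  extendZero_zero

theorem SmoothSpace.contDiffOn_nat {Q : Set V} (f : SmoothSpace Q) (k : ℕ) :
    ContDiffOn ℝ k f.ext Q := f.contDiffOn_ext.of_le (by exact_mod_cast le_top)

/-- The `k`-th derivative, as a linear map from `C^∞(Q)` to the space `C(Q, ·)` of continuous
functions (which carries the compact-open topology). -/
noncomputable def SmoothSpace.deriv (Q : Set V) [hQ : Fact (UniqueDiffOn ℝ Q)] (k : ℕ) :
    SmoothSpace Q →ₗ[ℝ] C(Q, ContinuousMultilinearMap ℝ (fun _ : Fin k => V) ℝ) where
  toFun f := ⟨fun x => iteratedFDerivWithin ℝ k f.ext Q x,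
    continuousOn_iff_continuous_domRestrict.1
      ((f.contDiffOn_nat k).continuousOn_iteratedFDerivWithin le_rfl hQ.out)⟩
  map_add' f g := by
    ext1 x
    simp only [ContinuousMap.coe_mk, ContinuousMap.add_apply, SmoothSpace.ext_add]
    exact iteratedFDerivWithin_add_apply (f.contDiffOn_nat k x x.2) (g.contDiffOn_nat k x x.2)
      hQ.out x.2
  map_smul' c f := by
    ext1 x
    simp only [ContinuousMap.coe_mk, ContinuousMap.smul_apply, SmoothSpace.ext_smul,
      RingHom.id_apply]
    exact iteratedFDerivWithin_const_smul_apply (f.contDiffOn_nat k x x.2) hQ.out x.2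

/-- The standard topology of `C^∞(Q)`: uniform convergence on compact subsets of `Q` of the
derivatives of every order. -/
noncomputable instance (Q : Set V) [Fact (UniqueDiffOn ℝ Q)] : TopologicalSpace (SmoothSpace Q) :=
  ⨅ k : ℕ, TopologicalSpace.induced (SmoothSpace.deriv Q k) inferInstance

instance (Q : Set V) [Fact (UniqueDiffOn ℝ Q)] : IsTopologicalAddGroup (SmoothSpace Q) :=
  topologicalAddGroup_iInf fun k => topologicalAddGroup_induced (SmoothSpace.deriv Q k)

instance (Q : Set V) [Fact (UniqueDiffOn ℝ Q)] : ContinuousSMul ℝ (SmoothSpace Q) :=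
  continuousSMul_iInf fun k => continuousSMul_induced (SmoothSpace.deriv Q k)

instance (Q : Set V) [Fact (UniqueDiffOn ℝ Q)] : LocallyConvexSpace ℝ (SmoothSpace Q) :=
  LocallyConvexSpace.iInf fun k => LocallyConvexSpace.induced (SmoothSpace.deriv Q k)

instance (Q : Set V) [Fact (UniqueDiffOn ℝ Q)] : T2Space (SmoothSpace Q) := by
  have hc : Continuous (SmoothSpace.deriv Q 0) :=
    continuous_iInf_dom (i := 0) continuous_induced_dom
  refine T2Space.of_injective_continuous (f := SmoothSpace.deriv Q 0) (fun f g h => ?_) hc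
  apply SmoothSpace.toFun_injective
  funext x
  have h1 := congrArg (fun w => w x 0) h
  simpa [SmoothSpace.deriv, SmoothSpace.ext, extendZero_apply] using h1

end FunctionSpaces

/-! ### The problem on the half-cylinder

Functions on `S¹` are functions on `ℝ` of period `1`. -/

/-- `ℝ₊ × ℝ`, with coordinates `(t, η)`. -/
def halfPlane : Set (ℝ × ℝ) := Set.Ici 0 ×ˢ Set.univ

/-- `ℝ₊ × ℝ × ℝ`, with coordinates `(t, η, ξ)`. -/
def halfSpace : Set (ℝ × ℝ × ℝ) := Set.Ici 0 ×ˢ Set.univ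

instance : Fact (UniqueDiffOn ℝ (Set.univ : Set ℝ)) := ⟨uniqueDiffOn_univ⟩

instance : Fact (UniqueDiffOn ℝ halfPlane) := ⟨(uniqueDiffOn_Ici 0).prod uniqueDiffOn_univ⟩

instance : Fact (UniqueDiffOn ℝ halfSpace) := ⟨(uniqueDiffOn_Ici 0).prod uniqueDiffOn_univ⟩

/-- `C^∞(S¹)`, with the subspace topology from `C^∞(ℝ)`. -/
noncomputable def smoothCircle : Submodule ℝ (SmoothSpace (Set.univ : Set ℝ)) where
  carrier := {f | ∀ η : ℝ, f.ext (η + 1) = f.ext η}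
  add_mem' {f g} hf hg η := by simp [SmoothSpace.ext_add, hf η, hg η]
  zero_mem' η := by simp [SmoothSpace.ext_zero]
  smul_mem' c f hf η := by simp [SmoothSpace.ext_smul, hf η]

/-- `C^∞(ℝ₊ × S¹)`, with the subspace topology from `C^∞(ℝ₊ × ℝ)`. -/
noncomputable def smoothHalfCylinder : Submodule ℝ (SmoothSpace halfPlane) where
  carrier := {f | ∀ t η : ℝ, f.ext (t, η + 1) = f.ext (t, η)}
  add_mem' {f g} hf hg t η := by simp [SmoothSpace.ext_add, hf t η, hg t η]
  zero_mem' t η := by simp [SmoothSpace.ext_zero]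
  smul_mem' c f hf t η := by simp [SmoothSpace.ext_smul, hf t η]

/-- The space `E₁` of the nonlinearities: the `φ ∈ C^∞(ℝ₊ × S¹ × ℝ)` such that for every `T` there
is some `M` with `φ (t, η, ξ) = 0` whenever `t ≤ T` and `M ≤ |ξ|`. It carries the subspace topology
from `C^∞(ℝ₊ × ℝ × ℝ)`. -/
noncomputable def nonlinearitySpace : Submodule ℝ (SmoothSpace halfSpace) where
  carrier := {φ | (∀ t η ξ : ℝ, φ.ext (t, η + 1, ξ) = φ.ext (t, η, ξ)) ∧
    ∀ T : ℝ, 0 ≤ T → ∃ M : ℝ, ∀ t η ξ : ℝ, 0 ≤ t → t ≤ T → M ≤ |ξ| → φ.ext (t, η, ξ) = 0}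
  add_mem' {f g} hf hg := by
    refine ⟨fun t η ξ => by simp [SmoothSpace.ext_add, hf.1 t η ξ, hg.1 t η ξ], fun T hT => ?_⟩
    obtain ⟨M, hM⟩ := hf.2 T hT
    obtain ⟨N, hN⟩ := hg.2 T hT
    refine ⟨max M N, fun t η ξ h0 h1 h2 => ?_⟩
    simp [SmoothSpace.ext_add, hM t η ξ h0 h1 (le_trans (le_max_left _ _) h2),
      hN t η ξ h0 h1 (le_trans (le_max_right _ _) h2)]
  zero_mem' := ⟨fun t η ξ => by simp [SmoothSpace.ext_zero],
    fun T _ => ⟨0, fun t η ξ _ _ _ => by simp [SmoothSpace.ext_zero]⟩⟩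
  smul_mem' c f hf := by
    refine ⟨fun t η ξ => by simp [SmoothSpace.ext_smul, hf.1 t η ξ], fun T hT => ?_⟩
    obtain ⟨M, hM⟩ := hf.2 T hT
    exact ⟨M, fun t η ξ h0 h1 h2 => by simp [SmoothSpace.ext_smul, hM t η ξ h0 h1 h2]⟩

/-- The space `E = C^∞(S¹) × E₁` of the data `(y₀, φ)`. -/
abbrev DataSpace : Type := smoothCircle × nonlinearitySpace

/-- The functions of class `C¹` on `ℝ₊ × S¹`. -/
def IsC1HalfCylinder (y : halfPlane → ℝ) : Prop :=
  y ∈ contDiffSubmodule 1 halfPlane ∧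
    ∀ t η : ℝ, extendZero y (t, η + 1) = extendZero y (t, η)

/-- The solution relation `Σ` of `y_t + y_θ = φ(t, θ, y)`, `y(0, ·) = y₀`: all `(y₀, φ, y)` with
`(y₀, φ) ∈ E`, `y` of class `C¹` on `ℝ₊ × S¹`, and
`y (t, η) = y₀ (η - t) + ∫₀ᵗ φ (τ, η - t + τ, y (τ, η - t + τ)) dτ`
for `t ≥ 0` and `η ∈ ℝ`. -/
noncomputable def solutionRelation : SetRel DataSpace (halfPlane → ℝ) :=
  {p | IsC1HalfCylinder p.2 ∧ ∀ t η : ℝ, 0 ≤ t →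
    extendZero p.2 (t, η) = p.1.1.1.ext (η - t) +
      ∫ τ in (0 : ℝ)..t, p.1.2.1.ext (τ, η - t + τ, extendZero p.2 (τ, η - t + τ))}

/-- The solution relation, read as the initial value problem for the differential equation. -/
theorem mem_solutionRelation_iff (x : DataSpace) (y : halfPlane → ℝ) :
    (x, y) ∈ solutionRelation ↔ IsC1HalfCylinder y ∧
      (∀ η : ℝ, extendZero y (0, η) = x.1.1.ext η) ∧
      ∀ t η : ℝ, 0 ≤ t →
        fderivWithin ℝ (extendZero y) halfPlane (t, η) (1, 0) +
          fderivWithin ℝ (extendZero y) halfPlane (t, η) (0, 1) =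
        x.2.1.ext (t, η, extendZero y (t, η)) := by
  change (IsC1HalfCylinder y ∧ ∀ t η : ℝ, 0 ≤ t →
    extendZero y (t, η) = x.1.1.ext (η - t) +
      ∫ τ in (0 : ℝ)..t, x.2.1.ext (τ, η - t + τ, extendZero y (τ, η - t + τ))) ↔ _
  refine and_congr_right fun hy => ?_
  set z := extendZero y with hz
  set φ := x.2.1.ext with hφ
  have hz1 : ContDiffOn ℝ 1 z halfPlane := hy.1
  have hmem : ∀ {t η : ℝ}, 0 ≤ t → (t, η) ∈ halfPlane := fun ht => ⟨ht, trivial⟩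
  have hg : ∀ c τ : ℝ, 0 ≤ τ → HasDerivWithinAt (fun s => z (s, c + s))
      (fderivWithin ℝ z halfPlane (τ, c + τ) (1, 0) + fderivWithin ℝ z halfPlane (τ, c + τ) (0, 1))
      (Set.Ici 0) τ := by
    intro c τ hτ
    have h1 : HasFDerivWithinAt z (fderivWithin ℝ z halfPlane (τ, c + τ)) halfPlane (τ, c + τ) :=
      ((hz1.differentiableOn (by simp)) _ (hmem hτ)).hasFDerivWithinAt
    have h2 : HasDerivWithinAt (fun s : ℝ => (s, c + s)) ((1 : ℝ), (1 : ℝ)) (Set.Ici 0) τ :=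
      ((hasDerivAt_id τ).prodMk ((hasDerivAt_id τ).const_add c)).hasDerivWithinAt
    have h3 := h1.comp_hasDerivWithinAt τ h2 (fun s hs => hmem hs)
    have h4 : ((1 : ℝ), (0 : ℝ)) + (0, 1) = (1, 1) := by simp
    rw [← map_add, h4]
    exact h3
  have hcont : ∀ c : ℝ, ContinuousOn (fun s => φ (s, c + s, z (s, c + s))) (Set.Ici 0) := by
    intro c
    have h1 : ContinuousOn (fun s => z (s, c + s)) (Set.Ici 0) :=
      fun τ hτ => (hg c τ hτ).continuousWithinAt
    refine (x.2.1.contDiffOn_ext.continuousOn).comp (t := halfSpace)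
      (continuousOn_id.prodMk ((continuousOn_const.add continuousOn_id).prodMk h1))
      (fun s hs => ⟨hs, trivial⟩)
  constructor
  · intro h
    refine ⟨fun η => by simpa using h 0 η le_rfl, fun t η ht => ?_⟩
    set c := η - t with hc
    have hη : η = c + t := by rw [hc]; ring
    set k : ℝ → ℝ := fun s => φ (max s 0, c + max s 0, z (max s 0, c + max s 0)) with hk
    have hkc : Continuous k := (hcont c).comp_continuous
      (continuous_id.max continuous_const) (fun s => Set.mem_Ici.2 (le_max_right _ _))
    have hd : HasDerivWithinAt (fun s => z (s, c + s)) (k t) (Set.Ici 0) t := by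
      have h1 : HasDerivAt (fun s => x.1.1.ext c + ∫ τ in (0 : ℝ)..s, k τ) (k t) t :=
        (intervalIntegral.integral_hasDerivAt_right (hkc.intervalIntegrable _ _)
          (hkc.stronglyMeasurableAtFilter _ _) hkc.continuousAt).const_add _
      refine h1.hasDerivWithinAt.congr_of_mem (fun s hs => ?_) ht
      have h2 := h s (c + s) hs
      rw [add_sub_cancel_right] at h2
      rw [h2]
      congr 1
      refine intervalIntegral.integral_congr fun τ hτ => ?_
      rw [Set.uIcc_of_le hs] at hτ
      simp [hk, max_eq_left hτ.1]
    have hu := (uniqueDiffOn_Ici (0 : ℝ) t ht).eq_deriv _ (hg c t ht) hd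
    rw [hη, hu]
    simp [hk, max_eq_left ht]
  · rintro ⟨h0, h1⟩ t η ht
    have h2 := intervalIntegral.integral_eq_sub_of_hasDeriv_right_of_le
      (f := fun s => z (s, η - t + s)) (f' := fun s => φ (s, η - t + s, z (s, η - t + s))) ht
      (fun s hs => ((hg (η - t) s hs.1).mono Set.Icc_subset_Ici_self).continuousWithinAt)
      (fun s hs => by
        have h3 := hg (η - t) s hs.1.le
        rw [h1 s _ hs.1.le] at h3
        exact h3.mono (fun r hr => hs.1.le.trans (le_of_lt hr)))
      (((hcont (η - t)).mono (by
        rw [Set.uIcc_of_le ht]; exact Set.Icc_subset_Ici_self)).intervalIntegrable)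
    rw [h2, add_zero, h0]
    simp

/-! On a characteristic `η = c + t` the problem is the scalar equation `y' = φ(t, c + t, y)`, `y(0)
= y₀(c)`. On `[0, T]` the right-hand side is bounded, because `φ` vanishes for large `|ξ|`, so
Picard–Lindelöf gives a solution on all of `[0, T]`. A Gronwall comparison
(`abs_sub_le_of_perturbed_ode`) gives uniqueness, hence also global solutions and periodicity in
`η`, and joint continuity in the data, the characteristic and the time.

Smoothness is a bootstrap. Differentiating the equation in the data or in `η` gives a linear
equation along the characteristics, solved by variation of constants. The resulting
`solutionFamilyX` and `solutionFamilyη` are built from the solution itself by superposition with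
derivatives of `φ`, products, exponentials and integrals along characteristics, and no derivative of
the solution enters. These operations preserve `DiffFamily n`; superposition does so because `φ ↦
∂φ` is continuous and linear on `C^∞`, so that losing a derivative of `φ` costs nothing. The
`t`-derivative is `φ(t, η, y) - y_η`. Hence a solution family of class `n` is of class `n + 1`
(`smoothFamily_solutionFamily`), starting from mere continuity. That the candidate derivatives are
derivatives is `hasDerivAt_solution_of_parameter`: by Hadamard's lemma a difference of two solutions
satisfies a linear equation exactly, and one passes to the limit in its explicit solution.

It remains to turn joint smoothness in data and point into Keller smoothness. Joint continuity of
all derivatives gives continuity into `C^∞` (`RegularFamily.continuous_toMap`). For the strong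
continuity of `D^l` one writes `D^l(x + v)u - D^l(x)u = ∫₀¹ D^{l+1}(x + rv)(u, v) dr`. The integral
is continuous when the base displacement and the last direction are treated as independent, and
linear in the last direction; replacing that direction by `ε⁻¹ v` therefore extracts the factor `ε`,
with one neighbourhood `U` for all `ε`.

Half-lines and half-spaces are handled by the convention `f x (max t 0) η = f x t η`, which makes
every family continuous for all real `t`. -/

set_option linter.unusedSectionVars false

/-! ### Two facts on integrals depending on a parameter -/

theorem hasDerivAt_intervalIntegral_of_continuous {F F' : ℝ → ℝ → ℝ}
    (hF : Continuous F.uncurry) (hF' : Continuous F'.uncurry)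
    (hd : ∀ s r, HasDerivAt (fun s => F s r) (F' s r) s) (a b s₀ : ℝ) :
    HasDerivAt (fun s => ∫ r in a..b, F s r) (∫ r in a..b, F' s₀ r) s₀ := by
  obtain ⟨C, hC⟩ := ((isCompact_closedBall s₀ 1).prod (isCompact_uIcc (a := a) (b := b))).exists_bound_of_continuousOn
    hF'.continuousOn
  have h1 : ∀ s, Continuous (F s) := fun s => hF.comp (Continuous.prodMk_right s)
  have h2 : ∀ s, Continuous (F' s) := fun s => hF'.comp (Continuous.prodMk_right s)
  refine (intervalIntegral.hasDerivAt_integral_of_dominated_loc_of_deriv_le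
    (F := F) (F' := F') (bound := fun _ => C) (s := Metric.closedBall s₀ 1)
    (Metric.closedBall_mem_nhds s₀ one_pos)
    (Filter.Eventually.of_forall fun s => (h1 s).aestronglyMeasurable)
    ((h1 s₀).intervalIntegrable _ _) (h2 s₀).aestronglyMeasurable
    (Filter.Eventually.of_forall fun r hr s hs => hC (s, r) ⟨hs, Set.uIoc_subset_uIcc hr⟩)
    intervalIntegrable_const
    (Filter.Eventually.of_forall fun r _ s _ => hd s r)).2

/-- A function with one-sided derivatives on `[0, ∞)` extends to a differentiable function. -/
theorem hasDerivAt_extend_Ici {g g' : ℝ → ℝ}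
    (hg : ∀ s, 0 ≤ s → HasDerivWithinAt g (g' s) (Set.Ici 0) s) (s : ℝ) :
    HasDerivAt (fun s => g (max s 0) + min s 0 * g' 0) (g' (max s 0)) s := by
  have hr : ∀ s, 0 ≤ s →
      HasDerivWithinAt (fun s => g (max s 0) + min s 0 * g' 0) (g' s) (Set.Ici 0) s := fun s hs =>
    (hg s hs).congr_of_mem
      (fun r hr => by simp [max_eq_left (Set.mem_Ici.1 hr), min_eq_right (Set.mem_Ici.1 hr)]) hs
  have hl : ∀ s, s ≤ 0 →
      HasDerivWithinAt (fun s => g (max s 0) + min s 0 * g' 0) (g' 0) (Set.Iic 0) s := fun s hs => by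
    have h : HasDerivAt (fun s => g 0 + s * g' 0) (g' 0) s := by
      simpa using ((hasDerivAt_id s).mul_const (g' 0)).const_add (g 0)
    exact h.hasDerivWithinAt.congr_of_mem
      (fun r hr => by simp [max_eq_right (Set.mem_Iic.1 hr), min_eq_left (Set.mem_Iic.1 hr)]) hs
  rcases lt_trichotomy s 0 with h | rfl | h
  · rw [max_eq_right h.le]
    exact (hl s h.le).hasDerivAt (Iic_mem_nhds h)
  · rw [max_self, ← hasDerivWithinAt_univ, ← Set.Iic_union_Ici (a := (0 : ℝ))]
    exact (hl 0 le_rfl).union (hr 0 le_rfl)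
  · rw [max_eq_left h.le]
    exact (hr s h.le).hasDerivAt (Ici_mem_nhds h)

/-- The integrand is continued affinely to `s < 0` with slope `F' 0 r`. The continuation is
differentiable with derivative `F' (max s 0) r`, again jointly continuous, so the two-sided case
applies. -/
theorem hasDerivWithinAt_intervalIntegral_of_continuous {F F' : ℝ → ℝ → ℝ}
    (hF : Continuous F.uncurry) (hF' : Continuous F'.uncurry)
    (hd : ∀ s r, 0 ≤ s → HasDerivWithinAt (fun s => F s r) (F' s r) (Set.Ici 0) s) (a b : ℝ)
    {s₀ : ℝ} (hs₀ : 0 ≤ s₀) :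
    HasDerivWithinAt (fun s => ∫ r in a..b, F s r) (∫ r in a..b, F' s₀ r) (Set.Ici 0) s₀ := by
  have h := hasDerivAt_intervalIntegral_of_continuous
    (F := fun s r => F (max s 0) r + min s 0 * F' 0 r) (F' := fun s r => F' (max s 0) r)
    ((hF.comp (by fun_prop : Continuous fun p : ℝ × ℝ => (max p.1 0, p.2))).add
      (by
        have := hF'.comp (by fun_prop : Continuous fun p : ℝ × ℝ => ((0 : ℝ), p.2))
        have h2 : Continuous fun p : ℝ × ℝ => min p.1 0 := by fun_prop
        exact h2.mul this))
    (hF'.comp (by fun_prop : Continuous fun p : ℝ × ℝ => (max p.1 0, p.2)))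
    (fun s r => hasDerivAt_extend_Ici (fun s hs => hd s r hs) s) a b s₀
  rw [max_eq_left hs₀] at h
  refine h.hasDerivWithinAt.congr_of_mem (fun s hs => ?_) hs₀
  simp [max_eq_left (Set.mem_Ici.1 hs), min_eq_right (Set.mem_Ici.1 hs)]

/-- A function on the half-plane with continuous partial derivatives is differentiable. -/
theorem hasFDerivWithinAt_halfPlane_of_partial {F F₂ : ℝ → ℝ → ℝ} {t₀ η₀ a : ℝ}
    (h1 : HasDerivWithinAt (fun t => F t η₀) a (Set.Ici 0) t₀)
    (h2 : ∀ t η, 0 ≤ t → HasDerivAt (F t) (F₂ t η) η)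
    (h3 : ContinuousWithinAt F₂.uncurry halfPlane (t₀, η₀)) :
    HasFDerivWithinAt (fun q : ℝ × ℝ => F q.1 q.2)
      (a • ContinuousLinearMap.fst ℝ ℝ ℝ + F₂ t₀ η₀ • ContinuousLinearMap.snd ℝ ℝ ℝ)
      halfPlane (t₀, η₀) := by
  have e1 : HasFDerivWithinAt (fun q : ℝ × ℝ => F q.1 η₀) (a • ContinuousLinearMap.fst ℝ ℝ ℝ)
      halfPlane (t₀, η₀) :=
    HasDerivWithinAt.comp_hasFDerivWithinAt (t := Set.Ici 0) (h₂ := fun t => F t η₀)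
      (f := Prod.fst) (t₀, η₀) h1 hasFDerivWithinAt_fst fun q hq => hq.1
  -- The increment in `η` is controlled by the mean value inequality on the segment from `η₀` to
  -- `q.2`, after subtracting the linear part. Only the `η`-derivative has to be continuous; the
  -- `t`-derivative is needed at one point.
  have e2 : HasFDerivWithinAt (fun q : ℝ × ℝ => F q.1 q.2 - F q.1 η₀)
      (F₂ t₀ η₀ • ContinuousLinearMap.snd ℝ ℝ ℝ) halfPlane (t₀, η₀) := by
    rw [hasFDerivWithinAt_iff_isLittleO, Asymptotics.isLittleO_iff]
    intro c hc
    obtain ⟨ε, hε, hb⟩ := Metric.mem_nhdsWithin_iff.1 (h3 (Metric.ball_mem_nhds _ hc))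
    filter_upwards [inter_mem_nhdsWithin _ (Metric.ball_mem_nhds _ hε)] with q hq
    have hd : ∀ η ∈ Set.uIcc η₀ q.2, HasDerivWithinAt (fun η => F q.1 η - F₂ t₀ η₀ * η)
        (F₂ q.1 η - F₂ t₀ η₀) (Set.uIcc η₀ q.2) η := fun η _ => by
      simpa using!
        ((h2 q.1 η hq.1.1).sub ((hasDerivAt_id η).const_mul (F₂ t₀ η₀))).hasDerivWithinAt
    have hbd : ∀ η ∈ Set.uIcc η₀ q.2, ‖F₂ q.1 η - F₂ t₀ η₀‖ ≤ c := fun η hη => by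
      have hm : (q.1, η) ∈ Metric.ball (t₀, η₀) ε ∩ halfPlane := by
        refine ⟨?_, hq.1.1, trivial⟩
        have := hq.2
        rw [Metric.mem_ball, Prod.dist_eq, max_lt_iff] at this ⊢
        refine ⟨this.1, lt_of_le_of_lt ?_ this.2⟩
        simpa [dist_comm, Real.dist_eq, abs_sub_comm] using Set.abs_sub_left_of_mem_uIcc hη
      exact (mem_ball_iff_norm.1 (hb hm)).le
    have := (convex_uIcc η₀ q.2).norm_image_sub_le_of_norm_hasDerivWithin_le hd hbd
      Set.left_mem_uIcc Set.right_mem_uIcc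
    calc _ = ‖F q.1 q.2 - F₂ t₀ η₀ * q.2 - (F q.1 η₀ - F₂ t₀ η₀ * η₀)‖ := by
          congr 1
          simp only [sub_self, sub_zero, smul_apply, ContinuousLinearMap.coe_snd',
            Prod.snd_sub, smul_eq_mul]
          ring
      _ ≤ _ := this
      _ ≤ _ := by
          gcongr
          exact norm_snd_le (q - (t₀, η₀))
  exact (e1.add e2).congr (fun q _ => by simp) (by simp)

/-! ### Directional derivatives on `C^∞(Q)` -/

theorem extendZero_eqOn {V : Type*} {Q : Set V} (g : V → ℝ) :
    Set.EqOn (extendZero (fun x : Q => g x)) g Q := fun x hx =>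
  extendZero_apply (fun x : Q => g x) ⟨x, hx⟩

section DirDeriv

variable {V : Type*} [NormedAddCommGroup V] [NormedSpace ℝ V] (Q : Set V)

/-- The restriction to `Q` of a function that is smooth on `Q`. -/
def SmoothSpace.mk {Q : Set V} (g : V → ℝ) (hg : ContDiffOn ℝ ((⊤ : ℕ∞) : WithTop ℕ∞) g Q) :
    SmoothSpace Q :=
  ⟨fun x => g x, hg.congr (extendZero_eqOn g)⟩

theorem SmoothSpace.mk_ext {Q : Set V} (g : V → ℝ)
    (hg : ContDiffOn ℝ ((⊤ : ℕ∞) : WithTop ℕ∞) g Q) :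
    Set.EqOn (SmoothSpace.mk g hg).ext g Q := extendZero_eqOn g

theorem SmoothSpace.hasFDerivWithinAt {Q : Set V} (f : SmoothSpace Q) {x : V} (hx : x ∈ Q) :
    HasFDerivWithinAt f.ext (fderivWithin ℝ f.ext Q x) Q x :=
  (f.contDiffOn_ext.differentiableOn (by simp) x hx).hasFDerivWithinAt

variable [hQ : Fact (UniqueDiffOn ℝ Q)]

theorem SmoothSpace.contDiffOn_fderivWithin {Q : Set V} [hQ : Fact (UniqueDiffOn ℝ Q)]
    (f : SmoothSpace Q) :
    ContDiffOn ℝ ((⊤ : ℕ∞) : WithTop ℕ∞) (fderivWithin ℝ f.ext Q) Q :=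
  f.contDiffOn_ext.fderivWithin hQ.out (by simp)

/-- The derivative in the direction `v`, as a linear map of `C^∞(Q)`. -/
noncomputable def SmoothSpace.dirDerivLinear (v : V) : SmoothSpace Q →ₗ[ℝ] SmoothSpace Q where
  toFun f := SmoothSpace.mk (fun x => fderivWithin ℝ f.ext Q x v)
    (f.contDiffOn_fderivWithin.clm_apply contDiffOn_const)
  map_add' f g := by
    apply SmoothSpace.toFun_injective
    funext x
    change fderivWithin ℝ (f + g).ext Q x v =
      fderivWithin ℝ f.ext Q x v + fderivWithin ℝ g.ext Q x v
    rw [SmoothSpace.ext_add, ((f.hasFDerivWithinAt x.2).add (g.hasFDerivWithinAt x.2)).fderivWithin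
      (hQ.out x x.2)]
    rfl
  map_smul' c f := by
    apply SmoothSpace.toFun_injective
    funext x
    change fderivWithin ℝ (c • f).ext Q x v = c • fderivWithin ℝ f.ext Q x v
    rw [SmoothSpace.ext_smul, ((f.hasFDerivWithinAt x.2).const_smul c).fderivWithin
      (hQ.out x x.2)]
    rfl

theorem SmoothSpace.continuous_deriv (k : ℕ) : Continuous (SmoothSpace.deriv Q k) :=
  continuous_iInf_dom (i := k) continuous_induced_dom

theorem SmoothSpace.continuous_iff {Q : Set V} [hQ : Fact (UniqueDiffOn ℝ Q)] {X : Type*}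
    [TopologicalSpace X] {g : X → SmoothSpace Q} :
    Continuous g ↔ ∀ k, Continuous fun x => SmoothSpace.deriv Q k (g x) := by
  refine ⟨fun h k => (SmoothSpace.continuous_deriv Q k).comp h, fun h => ?_⟩
  exact continuous_iInf_rng.2 fun k => continuous_induced_rng.2 (h k)

/-- The derivative in the direction `v`, as a continuous linear map of `C^∞(Q)`. -/
noncomputable def SmoothSpace.dirDeriv (v : V) : SmoothSpace Q →L[ℝ] SmoothSpace Q where
  toLinearMap := SmoothSpace.dirDerivLinear Q v
  cont := by
    refine SmoothSpace.continuous_iff.2 fun k => ?_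
    -- `A` inserts `v` in the last slot. It carries the derivative of order `k + 1` of `f` to the
    -- derivative of order `k` of `∂_v f`, and composition with a fixed continuous map is continuous
    -- for the compact-open topology.
    let A : ContinuousMultilinearMap ℝ (fun _ : Fin (k + 1) => V) ℝ →L[ℝ]
        ContinuousMultilinearMap ℝ (fun _ : Fin k => V) ℝ :=
      (ContinuousLinearMap.compContinuousMultilinearMapL ℝ (fun _ : Fin k => V) (V →L[ℝ] ℝ) ℝ
        (ContinuousLinearMap.apply ℝ ℝ v)).comp
        (continuousMultilinearCurryRightEquiv' ℝ k V ℝ).toContinuousLinearEquiv.toContinuousLinearMap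
    have : (fun f => SmoothSpace.deriv Q k (SmoothSpace.dirDerivLinear Q v f)) =
        fun f => (⟨A, A.continuous⟩ : C(_, _)).comp (SmoothSpace.deriv Q (k + 1) f) := by
      funext f
      ext x m
      change iteratedFDerivWithin ℝ k (SmoothSpace.mk _ _).ext Q x m =
        A (iteratedFDerivWithin ℝ (k + 1) f.ext Q x) m
      rw [iteratedFDerivWithin_congr (SmoothSpace.mk_ext _ _) x.2]
      have h := (ContinuousLinearMap.apply ℝ ℝ v).iteratedFDerivWithin_comp_left
        (f.contDiffOn_fderivWithin x x.2) hQ.out x.2 (i := k) (by exact_mod_cast le_top)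
      have h' := congrArg (fun w => w m) h
      refine h'.trans ?_
      simp only [A, iteratedFDerivWithin_succ_eq_comp_right hQ.out x.2]
      simp
    exact this ▸ (ContinuousMap.continuous_postcomp _).comp (SmoothSpace.continuous_deriv Q (k + 1))

theorem SmoothSpace.dirDeriv_ext {Q : Set V} [hQ : Fact (UniqueDiffOn ℝ Q)] (v : V)
    (f : SmoothSpace Q) {x : V} (hx : x ∈ Q) :
    (SmoothSpace.dirDeriv Q v f).ext x = fderivWithin ℝ f.ext Q x v :=
  SmoothSpace.mk_ext _ _ hx

/-- Evaluation is jointly continuous for the compact-open topology over a locally compact base. This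
is the source of all joint continuity in the data and the point. -/
theorem SmoothSpace.continuous_eval [LocallyCompactSpace Q] :
    Continuous fun p : SmoothSpace Q × Q => p.1.ext p.2 := by
  have h : Continuous fun p : SmoothSpace Q × Q => SmoothSpace.deriv Q 0 p.1 p.2 :=
    ((SmoothSpace.continuous_deriv Q 0).comp continuous_fst).eval continuous_snd
  have h2 := (ContinuousMultilinearMap.apply ℝ (fun _ : Fin 0 => V) ℝ 0).continuous.comp h
  exact h2

end DirDeriv

/-! ### Joint continuity of evaluation on the half-space and on the line. -/

theorem mem_halfSpace {t η ξ : ℝ} (ht : 0 ≤ t) : (t, η, ξ) ∈ halfSpace := ⟨ht, trivial⟩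

theorem mem_halfPlane {t η : ℝ} (ht : 0 ≤ t) : (t, η) ∈ halfPlane := ⟨ht, trivial⟩

theorem isClosed_halfSpace : IsClosed halfSpace := isClosed_Ici.prod isClosed_univ

instance : LocallyCompactSpace halfSpace :=
  isClosed_halfSpace.isClosedEmbedding_subtypeVal.locallyCompactSpace

instance : LocallyCompactSpace (Set.univ : Set ℝ) :=
  isClosed_univ.isClosedEmbedding_subtypeVal.locallyCompactSpace

theorem continuous_ext_halfSpace {X : Type*} [TopologicalSpace X] {μ : X → SmoothSpace halfSpace}
    {a b c : X → ℝ} (hμ : Continuous μ) (ha : Continuous a) (hb : Continuous b)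
    (hc : Continuous c) : Continuous fun x => (μ x).ext (max (a x) 0, b x, c x) := by
  have h : Continuous fun x => (⟨(max (a x) 0, b x, c x), mem_halfSpace (le_max_right _ _)⟩ :
      halfSpace) := by fun_prop
  exact (SmoothSpace.continuous_eval halfSpace).comp (hμ.prodMk h)

theorem continuous_ext_univ {X : Type*} [TopologicalSpace X]
    {l : X → SmoothSpace (Set.univ : Set ℝ)}
    {a : X → ℝ} (hl : Continuous l) (ha : Continuous a) : Continuous fun x => (l x).ext (a x) := by
  have h : Continuous fun x => (⟨a x, trivial⟩ : (Set.univ : Set ℝ)) := by fun_prop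
  exact (SmoothSpace.continuous_eval Set.univ).comp (hl.prodMk h)

theorem hasDerivAt_dirDeriv_univ (y : SmoothSpace (Set.univ : Set ℝ)) (c : ℝ) :
    HasDerivAt y.ext ((SmoothSpace.dirDeriv Set.univ 1 y).ext c) c := by
  rw [SmoothSpace.dirDeriv_ext _ _ (Set.mem_univ c)]
  have := y.hasFDerivWithinAt (Set.mem_univ c)
  rw [hasFDerivWithinAt_univ] at this
  exact this.hasDerivAt

/-! ### Smooth families of functions on the half-plane

A family of functions on `ℝ₊ × ℝ` with parameter in a topological vector space `X` is a function
`f : X → ℝ → ℝ → ℝ` with `f x (max t 0) η = f x t η`. -/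

section Families

universe u

/-- The jointly continuous families. -/
def ContFamily {X : Type u} [TopologicalSpace X] (f : X → ℝ → ℝ → ℝ) : Prop :=
  (Continuous fun p : X × ℝ × ℝ => f p.1 p.2.1 p.2.2) ∧ ∀ x t η, f x (max t 0) η = f x t η

/-- The directional derivative of a family in its parameter. -/
noncomputable def dX {X : Type u} [AddCommGroup X] [Module ℝ X] (f : X → ℝ → ℝ → ℝ) :
    X × X → ℝ → ℝ → ℝ :=
  fun p t η => deriv (fun s : ℝ => f (p.1 + s • p.2) t η) 0

/-- The derivative of a family with respect to `t`, one-sided at `0`. -/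
noncomputable def dT {X : Type u} (f : X → ℝ → ℝ → ℝ) : X → ℝ → ℝ → ℝ :=
  fun x t η => derivWithin (fun r => f x r η) (Set.Ici 0) (max t 0)

/-- The derivative of a family with respect to `η`. -/
noncomputable def dη {X : Type u} (f : X → ℝ → ℝ → ℝ) : X → ℝ → ℝ → ℝ :=
  fun x t η => deriv (f x t) η

/-- The family `f` has the derivatives `dT f` and `dη f`. -/
structure HasSpaceDerivs {X : Type u} (f : X → ℝ → ℝ → ℝ) : Prop where
  hT : ∀ x t η, 0 ≤ t → HasDerivWithinAt (fun r => f x r η) (dT f x t η) (Set.Ici 0) t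
  hη : ∀ x t η, HasDerivAt (f x t) (dη f x t η) η

/-- The family `f` has the derivatives `dX f`, `dT f` and `dη f`. -/
structure HasFamilyDerivs {X : Type u} [AddCommGroup X] [Module ℝ X]
    (f : X → ℝ → ℝ → ℝ) : Prop extends HasSpaceDerivs f where
  hX : ∀ x u t η, HasDerivAt (fun s : ℝ => f (x + s • u) t η) (dX f (x, u) t η) 0

/-- The families of `n` times differentiable functions on the half-plane whose derivatives depend
continuously on all variables. -/
def RegularFamily : ℕ → ∀ {X : Type u} [TopologicalSpace X], (X → ℝ → ℝ → ℝ) → Prop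
  | 0, _, _, f => ContFamily f
  | n + 1, _, _, f => ContFamily f ∧ HasSpaceDerivs f ∧
      RegularFamily n (dT f) ∧ RegularFamily n (dη f)

/-- The families that are `n` times continuously differentiable in all variables together. -/
def DiffFamily : ℕ → ∀ {X : Type u} [AddCommGroup X] [Module ℝ X] [TopologicalSpace X],
    (X → ℝ → ℝ → ℝ) → Prop
  | 0, _, _, _, _, f => ContFamily f
  | n + 1, _, _, _, _, f => ContFamily f ∧ HasFamilyDerivs f ∧
      DiffFamily n (dX f) ∧ DiffFamily n (dT f) ∧ DiffFamily n (dη f)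

/-- The smooth families. -/
def SmoothFamily {X : Type u} [AddCommGroup X] [Module ℝ X] [TopologicalSpace X]
    (f : X → ℝ → ℝ → ℝ) : Prop := ∀ n, DiffFamily n f

theorem ContFamily.continuous_comp {X : Type u} [TopologicalSpace X] {f : X → ℝ → ℝ → ℝ}
    (hf : ContFamily f) {Z : Type*} [TopologicalSpace Z] {a : Z → X}
    {b c : Z → ℝ} (ha : Continuous a) (hb : Continuous b) (hc : Continuous c) :
    Continuous fun z => f (a z) (b z) (c z) :=
  hf.1.comp (ha.prodMk (hb.prodMk hc))

theorem ContFamily.comp_continuous {X Y : Type u} [TopologicalSpace X] [TopologicalSpace Y]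
    {f : X → ℝ → ℝ → ℝ} (hf : ContFamily f) {a : Y → X} (ha : Continuous a) :
    ContFamily fun y => f (a y) :=
  ⟨hf.continuous_comp (ha.comp continuous_fst) (by fun_prop) (by fun_prop),
    fun _ t η => hf.2 _ t η⟩

theorem ContFamily.map₂ {X : Type u} [TopologicalSpace X] {f g : X → ℝ → ℝ → ℝ}
    (hf : ContFamily f) (hg : ContFamily g) {k : ℝ → ℝ → ℝ}
    (hk : Continuous k.uncurry) : ContFamily fun x t η => k (f x t η) (g x t η) :=
  ⟨hk.comp (hf.1.prodMk hg.1), fun x t η => by simp only [hf.2, hg.2]⟩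

theorem HasFamilyDerivs.hasDerivAt {X : Type u} [AddCommGroup X] [Module ℝ X]
    {f : X → ℝ → ℝ → ℝ} (hf : HasFamilyDerivs f) (x u : X) (t η s : ℝ) :
    HasDerivAt (fun s : ℝ => f (x + s • u) t η) (dX f (x + s • u, u) t η) s := by
  have h := hf.hX (x + s • u) u t η
  rw [← sub_self s] at h
  simpa [add_assoc, ← add_smul] using h.comp_sub_const s s

variable {X Y : Type u} [AddCommGroup X] [Module ℝ X] [TopologicalSpace X]
  [AddCommGroup Y] [Module ℝ Y] [TopologicalSpace Y] {f g : X → ℝ → ℝ → ℝ} {n : ℕ}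

theorem DiffFamily.cont (hf : DiffFamily n f) : ContFamily f := by
  cases n with
  | zero => exact hf
  | succ n => exact hf.1

theorem DiffFamily.derivs (hf : DiffFamily (n + 1) f) : HasFamilyDerivs f := hf.2.1

theorem DiffFamily.of_succ (hf : DiffFamily (n + 1) f) : DiffFamily n f := by
  induction n generalizing X with
  | zero => exact hf.1
  | succ n ih => exact ⟨hf.1, hf.2.1, ih hf.2.2.1, ih hf.2.2.2.1, ih hf.2.2.2.2⟩

theorem dT_eq {X : Type u} [TopologicalSpace X] {f f₂ : X → ℝ → ℝ → ℝ} (c2 : ContFamily f₂)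
    (h2 : ∀ x t η, 0 ≤ t → HasDerivWithinAt (fun r => f x r η) (f₂ x t η) (Set.Ici 0) t) :
    dT f = f₂ := by
  funext x t η
  rw [← c2.2]
  exact (h2 x _ η (le_max_right _ _)).derivWithin (uniqueDiffOn_Ici 0 _ (le_max_right t 0))

theorem dη_eq {X : Type u} {f f₃ : X → ℝ → ℝ → ℝ} (h3 : ∀ x t η, HasDerivAt (f x t) (f₃ x t η) η) :
    dη f = f₃ := by
  funext x t η
  exact (h3 x t η).deriv

/-- Derivatives are unique, so it suffices to exhibit any formulas for them that lie in the class.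
The closure properties below are all proved in this way. -/
theorem ContFamily.succ (hf : ContFamily f) {f₁ : X × X → ℝ → ℝ → ℝ} {f₂ f₃ : X → ℝ → ℝ → ℝ}
    (h1 : ∀ x u t η, HasDerivAt (fun s : ℝ => f (x + s • u) t η) (f₁ (x, u) t η) 0)
    (h2 : ∀ x t η, 0 ≤ t → HasDerivWithinAt (fun r => f x r η) (f₂ x t η) (Set.Ici 0) t)
    (h3 : ∀ x t η, HasDerivAt (f x t) (f₃ x t η) η)
    (c1 : DiffFamily n f₁) (c2 : DiffFamily n f₂) (c3 : DiffFamily n f₃) :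
    DiffFamily (n + 1) f := by
  have e1 : dX f = f₁ := by
    funext p t η
    exact (h1 p.1 p.2 t η).deriv
  have e2 := dT_eq c2.cont h2
  have e3 := dη_eq h3
  subst e1 e2 e3
  exact ⟨hf, ⟨⟨h2, h3⟩, h1⟩, c1, c2, c3⟩

theorem DiffFamily.regular (hf : DiffFamily n f) : RegularFamily n f := by
  induction n generalizing X with
  | zero => exact hf
  | succ n ih => exact ⟨hf.1, hf.2.1.toHasSpaceDerivs, ih hf.2.2.2.1, ih hf.2.2.2.2⟩

/-! ### Families without differentiability in the parameter. -/

section Regular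

variable {X Y : Type u} [TopologicalSpace X] [TopologicalSpace Y] {f : X → ℝ → ℝ → ℝ} {n : ℕ}

theorem RegularFamily.cont (hf : RegularFamily n f) : ContFamily f := by
  cases n with
  | zero => exact hf
  | succ n => exact hf.1

theorem ContFamily.regular_succ (hf : ContFamily f) {f₂ f₃ : X → ℝ → ℝ → ℝ}
    (h2 : ∀ x t η, 0 ≤ t → HasDerivWithinAt (fun r => f x r η) (f₂ x t η) (Set.Ici 0) t)
    (h3 : ∀ x t η, HasDerivAt (f x t) (f₃ x t η) η)
    (c2 : RegularFamily n f₂) (c3 : RegularFamily n f₃) : RegularFamily (n + 1) f := by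
  have e2 := dT_eq c2.cont h2
  have e3 := dη_eq h3
  subst e2 e3
  exact ⟨hf, ⟨h2, h3⟩, c2, c3⟩

/-- Since no derivative in the parameter is taken, continuity of `a` is enough. This is needed for
the nonlinear substitution `(x, v, u, r) ↦ (x + r v, u)` in `segmentAverage`. -/
theorem RegularFamily.comp_continuous (hf : RegularFamily n f) {a : Y → X} (ha : Continuous a) :
    RegularFamily n fun y => f (a y) := by
  induction n generalizing f with
  | zero => exact ContFamily.comp_continuous hf ha
  | succ n ih =>
    exact (hf.cont.comp_continuous ha).regular_succ (fun y => hf.2.1.hT (a y))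
      (fun y => hf.2.1.hη (a y)) (ih hf.2.2.1) (ih hf.2.2.2)

/-- The integral of a family over `[0, 1]` in an additional parameter. -/
noncomputable def average {X : Type u} (f : X × ℝ → ℝ → ℝ → ℝ) : X → ℝ → ℝ → ℝ :=
  fun x t η => ∫ r in (0 : ℝ)..1, f (x, r) t η

theorem RegularFamily.average {f : X × ℝ → ℝ → ℝ → ℝ} (hf : RegularFamily n f) :
    RegularFamily n (average f) := by
  have hc : ∀ {f : X × ℝ → ℝ → ℝ → ℝ}, ContFamily f →
      ContFamily (_root_.average f) := fun {f} hf => by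
    refine ⟨?_, fun x t η => by simp only [_root_.average, hf.2]⟩
    have : Continuous (Function.uncurry fun (p : X × ℝ × ℝ) (r : ℝ) => f (p.1, r) p.2.1 p.2.2) :=
      hf.continuous_comp (by fun_prop) (by fun_prop) (by fun_prop)
    exact intervalIntegral.continuous_parametric_intervalIntegral_of_continuous' this 0 1
  induction n generalizing f with
  | zero => exact hc hf
  | succ n ih =>
    have c2 := hf.2.2.1.cont
    have c3 := hf.2.2.2.cont
    refine (hc hf.cont).regular_succ (f₂ := _root_.average (dT f)) (f₃ := _root_.average (dη f))
      (fun x t η ht => ?_) (fun x t η => ?_) (ih hf.2.2.1) (ih hf.2.2.2)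
    · exact hasDerivWithinAt_intervalIntegral_of_continuous
        (F := fun s r => f (x, r) s η) (F' := fun s r => dT f (x, r) s η)
        (hf.cont.continuous_comp (by fun_prop) (by fun_prop) (by fun_prop))
        (c2.continuous_comp (by fun_prop) (by fun_prop) (by fun_prop))
        (fun s r hs => hf.2.1.hT (x, r) s η hs) 0 1 ht
    · exact hasDerivAt_intervalIntegral_of_continuous
        (F := fun s r => f (x, r) t s) (F' := fun s r => dη f (x, r) t s)
        (hf.cont.continuous_comp (by fun_prop) (by fun_prop) (by fun_prop))
        (c3.continuous_comp (by fun_prop) (by fun_prop) (by fun_prop))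
        (fun s r => hf.2.1.hη (x, r) t s) 0 1 η

end Regular

theorem SmoothFamily.cont (hf : SmoothFamily f) : ContFamily f := hf 0

theorem SmoothFamily.derivs (hf : SmoothFamily f) : HasFamilyDerivs f := (hf 1).2.1

theorem SmoothFamily.smooth_dX (hf : SmoothFamily f) : SmoothFamily (dX f) :=
  fun n => (hf (n + 1)).2.2.1

/-! ### Closure under linear substitutions and algebraic operations. -/

theorem DiffFamily.comp_clm (hf : DiffFamily n f) (a : Y →L[ℝ] X) :
    DiffFamily n fun y => f (a y) := by
  induction n generalizing X Y with
  | zero => exact ContFamily.comp_continuous hf a.continuous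
  | succ n ih =>
    refine (hf.cont.comp_continuous a.continuous).succ (f₁ := fun p => dX f (a p.1, a p.2))
      (f₂ := fun y => dT f (a y)) (f₃ := fun y => dη f (a y)) (fun x u t η => ?_)
      (fun x t η => hf.derivs.hT _ t η) (fun x t η => hf.derivs.hη _ t η)
      (ih hf.2.2.1 (a.prodMap a)) (ih hf.2.2.2.1 a) (ih hf.2.2.2.2 a)
    simpa using hf.derivs.hX (a x) (a u) t η

theorem SmoothFamily.comp_clm (hf : SmoothFamily f) (a : Y →L[ℝ] X) :
    SmoothFamily fun y => f (a y) := fun n => (hf n).comp_clm a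

theorem DiffFamily.comp_fst (hf : DiffFamily n f) : DiffFamily n fun p : X × Y => f p.1 :=
  hf.comp_clm (ContinuousLinearMap.fst ℝ X Y)

theorem diffFamily_const (c : ℝ) : DiffFamily n fun (_ : X) _ _ => c := by
  induction n generalizing X c with
  | zero => exact ⟨continuous_const, fun _ _ _ => rfl⟩
  | succ n ih =>
    exact ContFamily.succ ⟨continuous_const, fun _ _ _ => rfl⟩
      (fun _ _ _ _ => hasDerivAt_const _ _) (fun _ _ _ _ => hasDerivWithinAt_const _ _ _)
      (fun _ _ _ => hasDerivAt_const _ _) (ih 0) (ih 0) (ih 0)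

theorem DiffFamily.add (hf : DiffFamily n f) (hg : DiffFamily n g) :
    DiffFamily n fun x t η => f x t η + g x t η := by
  induction n generalizing X with
  | zero => exact hf.cont.map₂ hg.cont continuous_add
  | succ n ih =>
    exact (hf.cont.map₂ hg.cont continuous_add).succ
      (fun x u t η => (hf.derivs.hX x u t η).add (hg.derivs.hX x u t η))
      (fun x t η ht => (hf.derivs.hT x t η ht).add (hg.derivs.hT x t η ht))
      (fun x t η => (hf.derivs.hη x t η).add (hg.derivs.hη x t η))
      (ih hf.2.2.1 hg.2.2.1) (ih hf.2.2.2.1 hg.2.2.2.1) (ih hf.2.2.2.2 hg.2.2.2.2)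

theorem DiffFamily.mul (hf : DiffFamily n f) (hg : DiffFamily n g) :
    DiffFamily n fun x t η => f x t η * g x t η := by
  induction n generalizing X with
  | zero => exact hf.cont.map₂ hg.cont continuous_mul
  | succ n ih =>
    refine (hf.cont.map₂ hg.cont continuous_mul).succ
      (f₁ := fun p t η => dX f p t η * g p.1 t η + f p.1 t η * dX g p t η)
      (f₂ := fun x t η => dT f x t η * g x t η + f x t η * dT g x t η)
      (f₃ := fun x t η => dη f x t η * g x t η + f x t η * dη g x t η)
      (fun x u t η => ?_)
      (fun x t η ht => (hf.derivs.hT x t η ht).mul (hg.derivs.hT x t η ht))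
      (fun x t η => (hf.derivs.hη x t η).mul (hg.derivs.hη x t η))
      ((ih hf.2.2.1 hg.of_succ.comp_fst).add (ih hf.of_succ.comp_fst hg.2.2.1))
      ((ih hf.2.2.2.1 hg.of_succ).add (ih hf.of_succ hg.2.2.2.1))
      ((ih hf.2.2.2.2 hg.of_succ).add (ih hf.of_succ hg.2.2.2.2))
    simpa using! (hf.derivs.hX x u t η).mul (hg.derivs.hX x u t η)

theorem DiffFamily.neg (hf : DiffFamily n f) : DiffFamily n fun x t η => -f x t η := by
  simpa using (diffFamily_const (-1)).mul hf

theorem DiffFamily.exp (hf : DiffFamily n f) : DiffFamily n fun x t η => Real.exp (f x t η) := by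
  induction n generalizing X with
  | zero => exact hf.cont.map₂ hf.cont (k := fun a _ => Real.exp a) (by fun_prop)
  | succ n ih =>
    refine (hf.cont.map₂ hf.cont (k := fun a _ => Real.exp a) (by fun_prop)).succ
      (f₁ := fun p t η => Real.exp (f p.1 t η) * dX f p t η) (fun x u t η => ?_)
      (fun x t η ht => (hf.derivs.hT x t η ht).exp)
      (fun x t η => (hf.derivs.hη x t η).exp)
      ((ih hf.of_succ).comp_fst.mul hf.2.2.1)
      ((ih hf.of_succ).mul hf.2.2.2.1) ((ih hf.of_succ).mul hf.2.2.2.2)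
    simpa using (hf.derivs.hX x u t η).exp

/-! #### Evaluation of smooth functions -/

/-- The class of these families is closed under differentiation: linearity replaces `l` by its value
on the direction, and the space derivatives replace it by `± ∂ ∘ l`. Hence the induction runs over
all `l` and all `X` at once. -/
theorem diffFamily_eval_univ (l : X →L[ℝ] SmoothSpace (Set.univ : Set ℝ)) :
    DiffFamily n fun x t η => (l x).ext (η - max t 0) := by
  have h0 : ∀ {X : Type u} [AddCommGroup X] [Module ℝ X] [TopologicalSpace X]
      (l : X →L[ℝ] SmoothSpace (Set.univ : Set ℝ)),
      ContFamily fun x t η => (l x).ext (η - max t 0) := fun l =>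
    ⟨continuous_ext_univ (l.continuous.comp continuous_fst) (by fun_prop), fun x t η => by simp⟩
  induction n generalizing X with
  | zero => exact h0 l
  | succ n ih =>
    have hd := fun x c => hasDerivAt_dirDeriv_univ (l x) c
    refine (h0 l).succ (f₁ := fun p t η => (l p.2).ext (η - max t 0))
      (f₂ := fun x t η => -(SmoothSpace.dirDeriv Set.univ 1 (l x)).ext (η - max t 0))
      (f₃ := fun x t η => (SmoothSpace.dirDeriv Set.univ 1 (l x)).ext (η - max t 0))
      (fun x u t η => ?_) (fun x t η ht => ?_) (fun x t η => ?_)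
      (ih (l.comp (ContinuousLinearMap.snd ℝ X X)))
      (ih ((SmoothSpace.dirDeriv Set.univ 1).comp l)).neg
      (ih ((SmoothSpace.dirDeriv Set.univ 1).comp l))
    · simp only [map_add, map_smul, SmoothSpace.ext_add, SmoothSpace.ext_smul, Pi.add_apply,
        Pi.smul_apply, smul_eq_mul]
      simpa using ((hasDerivAt_id (0 : ℝ)).mul_const ((l u).ext (η - max t 0))).const_add
        ((l x).ext (η - max t 0))
    · have h1 : HasDerivAt (fun r => (l x).ext (η - r))
          (-(SmoothSpace.dirDeriv Set.univ 1 (l x)).ext (η - max t 0)) t := by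
        rw [max_eq_left ht]
        simpa using! (hd x (η - t)).comp t ((hasDerivAt_id t).const_sub η)
      exact h1.hasDerivWithinAt.congr_of_mem (fun r hr => by rw [max_eq_left hr]) ht
    · exact (hd x (η - max t 0)).comp_sub_const η (max t 0)

theorem SmoothSpace.hasDerivWithinAt_comp (φ : SmoothSpace halfSpace) {s : Set ℝ}
    {γ : ℝ → ℝ × ℝ × ℝ} {a b c r : ℝ} (hγ : HasDerivWithinAt γ (a, b, c) s r)
    (hs : Set.MapsTo γ s halfSpace) (hr : γ r ∈ halfSpace) :
    HasDerivWithinAt (fun r => φ.ext (γ r))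
      (a * (SmoothSpace.dirDeriv halfSpace (1, 0, 0) φ).ext (γ r) +
        b * (SmoothSpace.dirDeriv halfSpace (0, 1, 0) φ).ext (γ r) +
        c * (SmoothSpace.dirDeriv halfSpace (0, 0, 1) φ).ext (γ r)) s r := by
  have h := (φ.hasFDerivWithinAt hr).comp_hasDerivWithinAt r hγ hs
  simp only [SmoothSpace.dirDeriv_ext _ _ hr]
  refine h.congr_deriv ?_
  have : ((a, b, c) : ℝ × ℝ × ℝ) = a • (1, 0, 0) + b • (0, 1, 0) + c • (0, 0, 1) := by simp
  rw [this]
  simp only [map_add, map_smul, smul_eq_mul]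

theorem SmoothSpace.hasDerivAt_comp (φ : SmoothSpace halfSpace)
    {γ : ℝ → ℝ × ℝ × ℝ} {a b c r : ℝ} (hγ : HasDerivAt γ (a, b, c) r)
    (hs : ∀ r, γ r ∈ halfSpace) :
    HasDerivAt (fun r => φ.ext (γ r))
      (a * (SmoothSpace.dirDeriv halfSpace (1, 0, 0) φ).ext (γ r) +
        b * (SmoothSpace.dirDeriv halfSpace (0, 1, 0) φ).ext (γ r) +
        c * (SmoothSpace.dirDeriv halfSpace (0, 0, 1) φ).ext (γ r)) r := by
  rw [← hasDerivWithinAt_univ] at hγ ⊢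
  exact φ.hasDerivWithinAt_comp hγ (fun r _ => hs r) (hs r)

/-- The expression is linear in `μ`, and the chain rule in `f` produces the same expression for `∂ ∘
μ`, times a derivative of `f`. As `∂` is continuous on `C^∞`, `∂ ∘ μ` is again admissible and the
induction closes for all `μ` together. -/
theorem DiffFamily.nemytskii (μ : X →L[ℝ] SmoothSpace halfSpace) (hf : DiffFamily n f) :
    DiffFamily n fun x t η => (μ x).ext (max t 0, η, f x t η) := by
  have h0 : ContFamily fun x t η => (μ x).ext (max t 0, η, f x t η) :=
    ⟨continuous_ext_halfSpace (μ.continuous.comp continuous_fst) (by fun_prop) (by fun_prop)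
      hf.cont.1, fun x t η => by simp [hf.cont.2]⟩
  induction n generalizing X with
  | zero => exact h0
  | succ n ih =>
    have hN : ∀ (ν : X →L[ℝ] SmoothSpace halfSpace),
        DiffFamily n fun x t η => (ν x).ext (max t 0, η, f x t η) := fun ν =>
      ih ν hf.of_succ ⟨continuous_ext_halfSpace (ν.continuous.comp continuous_fst) (by fun_prop)
        (by fun_prop) hf.cont.1, fun x t η => by simp [hf.cont.2]⟩
    have hN2 : DiffFamily n fun (p : X × X) t η => (μ p.2).ext (max t 0, η, f p.1 t η) :=
      ih (μ.comp (ContinuousLinearMap.snd ℝ X X)) hf.of_succ.comp_fst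
        ⟨continuous_ext_halfSpace (μ.continuous.comp (continuous_snd.comp continuous_fst))
          (by fun_prop) (by fun_prop) hf.of_succ.comp_fst.cont.1, fun x t η => by simp [hf.cont.2]⟩
    refine h0.succ
      (f₁ := fun p t η => (μ p.2).ext (max t 0, η, f p.1 t η) + dX f p t η *
        (SmoothSpace.dirDeriv halfSpace (0, 0, 1) (μ p.1)).ext (max t 0, η, f p.1 t η))
      (f₂ := fun x t η =>
        (SmoothSpace.dirDeriv halfSpace (1, 0, 0) (μ x)).ext (max t 0, η, f x t η) + dT f x t η *
        (SmoothSpace.dirDeriv halfSpace (0, 0, 1) (μ x)).ext (max t 0, η, f x t η))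
      (f₃ := fun x t η =>
        (SmoothSpace.dirDeriv halfSpace (0, 1, 0) (μ x)).ext (max t 0, η, f x t η) + dη f x t η *
        (SmoothSpace.dirDeriv halfSpace (0, 0, 1) (μ x)).ext (max t 0, η, f x t η))
      (fun x u t η => ?_) (fun x t η ht => ?_) (fun x t η => ?_)
      (hN2.add (hf.2.2.1.mul (hN ((SmoothSpace.dirDeriv halfSpace (0, 0, 1)).comp μ)).comp_fst))
      ((hN ((SmoothSpace.dirDeriv halfSpace (1, 0, 0)).comp μ)).add
        (hf.2.2.2.1.mul (hN ((SmoothSpace.dirDeriv halfSpace (0, 0, 1)).comp μ))))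
      ((hN ((SmoothSpace.dirDeriv halfSpace (0, 1, 0)).comp μ)).add
        (hf.2.2.2.2.mul (hN ((SmoothSpace.dirDeriv halfSpace (0, 0, 1)).comp μ))))
    · have hγ : HasDerivAt (fun s : ℝ => (max t 0, η, f (x + s • u) t η)) (0, 0, dX f (x, u) t η) 0 :=
        (hasDerivAt_const _ _).prodMk ((hasDerivAt_const _ _).prodMk (hf.derivs.hX x u t η))
      have h1 := (μ x).hasDerivAt_comp hγ fun _ => mem_halfSpace (le_max_right _ _)
      have h2 := (μ u).hasDerivAt_comp hγ fun _ => mem_halfSpace (le_max_right _ _)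
      -- Here `μ (x + s • u) = μ x + s • μ u`. In the product rule for the second summand, the term
      -- with the derivative of the evaluation carries the factor `s = 0`.
      have h3 := h1.add ((hasDerivAt_id (0 : ℝ)).mul h2)
      simp only [map_add, map_smul, SmoothSpace.ext_add, SmoothSpace.ext_smul, Pi.add_apply,
        Pi.smul_apply, smul_eq_mul]
      simpa [add_comm] using! h3
    · have hγ : HasDerivWithinAt (fun r : ℝ => (r, η, f x r η)) (1, 0, dT f x t η) (Set.Ici 0) t :=
        (hasDerivWithinAt_id _ _).prodMk
          ((hasDerivWithinAt_const _ _ _).prodMk (hf.derivs.hT x t η ht))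
      have h1 := (μ x).hasDerivWithinAt_comp hγ (fun r hr => mem_halfSpace hr) (mem_halfSpace ht)
      have h2 := h1.congr_of_mem (f₁ := fun r => (μ x).ext (max r 0, η, f x r η))
        (fun r hr => by rw [max_eq_left hr]) ht
      simpa [max_eq_left ht] using h2
    · have hγ : HasDerivAt (fun r : ℝ => (max t 0, r, f x t r)) (0, 1, dη f x t η) η :=
        (hasDerivAt_const _ _).prodMk ((hasDerivAt_id _).prodMk (hf.derivs.hη x t η))
      have h1 := (μ x).hasDerivAt_comp hγ fun _ => mem_halfSpace (le_max_right _ _)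
      simpa using h1

/-! #### Integrals of families -/

section Integrals

variable [ContinuousAdd X] [ContinuousSMul ℝ X]

/-- The integral of a family along the characteristics of `∂/∂t + ∂/∂η`. -/
noncomputable def transport {X : Type u} (f : X → ℝ → ℝ → ℝ) : X → ℝ → ℝ → ℝ :=
  fun x t η => ∫ τ in (0 : ℝ)..max t 0, f x τ (η - max t 0 + τ)

theorem ContFamily.transport {X : Type u} [TopologicalSpace X] {f : X → ℝ → ℝ → ℝ}
    (hf : ContFamily f) : ContFamily (transport f) := by
  refine ⟨?_, fun x t η => by simp [_root_.transport]⟩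
  have : Continuous (Function.uncurry fun (p : X × ℝ × ℝ) (τ : ℝ) =>
      f p.1 τ (p.2.2 - max p.2.1 0 + τ)) :=
    hf.continuous_comp (by fun_prop) (by fun_prop) (by fun_prop)
  exact intervalIntegral.continuous_parametric_intervalIntegral_of_continuous this
    (s := fun p : X × ℝ × ℝ => max p.2.1 0) (by fun_prop)

/-- The upper limit `r` and the starting point `c` of the characteristic are separated into a
function `K r c` of two variables, which is then differentiated along `(r, η - r)`. -/
theorem hasDerivWithinAt_transport {f f' : ℝ → ℝ → ℝ} (hf : Continuous f.uncurry)
    (hf' : Continuous f'.uncurry) (hd : ∀ t η, HasDerivAt (f t) (f' t η) η) {t η : ℝ} :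
    HasDerivWithinAt (fun r => ∫ τ in (0 : ℝ)..r, f τ (η - r + τ))
      (f t η - ∫ τ in (0 : ℝ)..t, f' τ (η - t + τ)) (Set.Ici 0) t := by
  set K : ℝ → ℝ → ℝ := fun r c => ∫ τ in (0 : ℝ)..r, f τ (c + τ) with hK
  set K₂ : ℝ → ℝ → ℝ := fun r c => ∫ τ in (0 : ℝ)..r, f' τ (c + τ) with hK₂
  have h1 : HasDerivAt (fun r => K r (η - t)) (f t η) t := by
    have hc : Continuous fun τ => f τ (η - t + τ) :=
      hf.comp (by fun_prop : Continuous fun τ : ℝ => (τ, η - t + τ))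
    have := intervalIntegral.integral_hasDerivAt_right (hc.intervalIntegrable 0 t)
      (hc.stronglyMeasurableAtFilter _ _) hc.continuousAt
    simpa using this
  have h2 : ∀ r c, HasDerivAt (K r) (K₂ r c) c := fun r c =>
    hasDerivAt_intervalIntegral_of_continuous
      (F := fun s τ => f τ (s + τ)) (F' := fun s τ => f' τ (s + τ))
      (hf.comp (by fun_prop : Continuous fun p : ℝ × ℝ => (p.2, p.1 + p.2)))
      (hf'.comp (by fun_prop : Continuous fun p : ℝ × ℝ => (p.2, p.1 + p.2)))
      (fun s τ => (hd τ (s + τ)).comp_add_const s τ) 0 r c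
  have h3 : Continuous K₂.uncurry := by
    have : Continuous (Function.uncurry fun (p : ℝ × ℝ) (τ : ℝ) => f' τ (p.2 + τ)) :=
      hf'.comp (by fun_prop : Continuous fun p : (ℝ × ℝ) × ℝ => (p.2, p.1.2 + p.2))
    exact intervalIntegral.continuous_parametric_intervalIntegral_of_continuous this
      (s := fun p : ℝ × ℝ => p.1) (by fun_prop)
  have h4 := hasFDerivWithinAt_halfPlane_of_partial (F := K) (F₂ := K₂) h1.hasDerivWithinAt
    (fun r c _ => h2 r c) h3.continuousWithinAt
  have h5 : HasDerivWithinAt (fun r : ℝ => (r, η - r)) (1, -1) (Set.Ici 0) t :=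
    ((hasDerivAt_id t).prodMk ((hasDerivAt_id t).const_sub η)).hasDerivWithinAt
  have h6 := h4.comp_hasDerivWithinAt t h5 (fun r hr => mem_halfPlane hr)
  refine h6.congr_deriv ?_
  simp [hK₂, sub_eq_add_neg]

/-- The `t`-derivative is `f - transport (dη f)`, so all three derivatives are built from `f` and
transports of derivatives of `f`, and the induction closes. -/
theorem DiffFamily.transport (hf : DiffFamily n f) : DiffFamily n (transport f) := by
  induction n generalizing X with
  | zero => exact ContFamily.transport hf
  | succ n ih =>
    have c1 := hf.2.2.1.cont
    have c3 := hf.2.2.2.2.cont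
    refine hf.cont.transport.succ (f₁ := _root_.transport (dX f))
      (f₂ := fun x t η => f x t η + -_root_.transport (dη f) x t η) (f₃ := _root_.transport (dη f))
      (fun x u t η => ?_) (fun x t η ht => ?_) (fun x t η => ?_)
      (ih hf.2.2.1) (hf.of_succ.add (ih hf.2.2.2.2).neg) (ih hf.2.2.2.2)
    · have h := hasDerivAt_intervalIntegral_of_continuous
        (F := fun s τ => f (x + s • u) τ (η - max t 0 + τ))
        (F' := fun s τ => dX f (x + s • u, u) τ (η - max t 0 + τ))
        (hf.cont.continuous_comp (by fun_prop) (by fun_prop) (by fun_prop))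
        (c1.continuous_comp (by fun_prop) (by fun_prop) (by fun_prop))
        (fun s τ => hf.derivs.hasDerivAt x u _ _ s) 0 (max t 0) 0
      simpa using! h
    · have h := hasDerivWithinAt_transport (f := f x) (f' := dη f x) (η := η)
        (hf.cont.continuous_comp continuous_const continuous_fst continuous_snd)
        (c3.continuous_comp continuous_const continuous_fst continuous_snd)
        (fun t η => hf.derivs.hη x t η) (t := t)
      rw [sub_eq_add_neg] at h
      refine (h.congr_of_mem (fun r hr => ?_) ht).congr_deriv ?_
      · simp only [_root_.transport, max_eq_left (Set.mem_Ici.1 hr)]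
      · simp only [_root_.transport, max_eq_left ht]
    · exact hasDerivAt_intervalIntegral_of_continuous
        (F := fun s τ => f x τ (s - max t 0 + τ)) (F' := fun s τ => dη f x τ (s - max t 0 + τ))
        (hf.cont.continuous_comp (by fun_prop) (by fun_prop) (by fun_prop))
        (c3.continuous_comp (by fun_prop) (by fun_prop) (by fun_prop))
        (fun s τ => by
          simpa [sub_add] using (hf.derivs.hη x τ (s - (max t 0 - τ))).comp_sub_const s (max t 0 - τ))
        0 (max t 0) η

/-- The solution of `w_t + w_η = β w + α`, `w(0, ·) = a`, where `a` is constant along the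
characteristics. -/
noncomputable def linearSolution {X : Type u} (β a α : X → ℝ → ℝ → ℝ) : X → ℝ → ℝ → ℝ :=
  fun x t η => Real.exp (transport β x t η) *
    (a x t η + transport (fun x t η => Real.exp (-transport β x t η) * α x t η) x t η)

theorem DiffFamily.linearSolution {β a α : X → ℝ → ℝ → ℝ} (hβ : DiffFamily n β)
    (ha : DiffFamily n a) (hα : DiffFamily n α) : DiffFamily n (linearSolution β a α) :=
  hβ.transport.exp.mul (ha.add (hβ.transport.neg.exp.mul hα).transport)

end Integrals

end Families

/-! ### Smooth families as smooth maps to `C^∞(ℝ₊ × S¹)` -/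

section FamilyMaps

universe u

variable {X : Type u} [TopologicalSpace X]
  {f : X → ℝ → ℝ → ℝ}

theorem RegularFamily.hasFDerivWithinAt (hf : ∀ n, RegularFamily n f) (x : X) {q : ℝ × ℝ}
    (hq : q ∈ halfPlane) :
    HasFDerivWithinAt (fun q : ℝ × ℝ => f x q.1 q.2)
      (dT f x q.1 q.2 • ContinuousLinearMap.fst ℝ ℝ ℝ +
        dη f x q.1 q.2 • ContinuousLinearMap.snd ℝ ℝ ℝ) halfPlane q :=
  hasFDerivWithinAt_halfPlane_of_partial (F := f x) (F₂ := dη f x) ((hf 1).2.1.hT x q.1 q.2 hq.1)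
    (fun t η _ => (hf 1).2.1.hη x t η)
    ((hf 1).2.2.2.cont.continuous_comp continuous_const continuous_fst
      continuous_snd).continuousWithinAt

theorem uniqueDiffOn_halfPlane : UniqueDiffOn ℝ halfPlane := Fact.out

theorem RegularFamily.eqOn_fderivWithin (hf : ∀ n, RegularFamily n f) (x : X) :
    Set.EqOn (fderivWithin ℝ (fun q : ℝ × ℝ => f x q.1 q.2) halfPlane)
      (fun q => dT f x q.1 q.2 • ContinuousLinearMap.fst ℝ ℝ ℝ +
        dη f x q.1 q.2 • ContinuousLinearMap.snd ℝ ℝ ℝ) halfPlane := fun q hq => by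
  simpa using (RegularFamily.hasFDerivWithinAt hf x hq).fderivWithin (uniqueDiffOn_halfPlane q hq)

theorem RegularFamily.contDiffOn (hf : ∀ n, RegularFamily n f) (x : X) (k : ℕ) :
    ContDiffOn ℝ k (fun q : ℝ × ℝ => f x q.1 q.2) halfPlane := by
  induction k generalizing f with
  | zero =>
    exact contDiffOn_zero.2
      ((hf 0).cont.continuous_comp continuous_const continuous_fst continuous_snd).continuousOn
  | succ k ih =>
    have h : ContDiffOn ℝ k (fderivWithin ℝ (fun q : ℝ × ℝ => f x q.1 q.2) halfPlane) halfPlane :=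
      (((ih (fun n => (hf (n + 1)).2.2.1)).smul contDiffOn_const).add
        ((ih (fun n => (hf (n + 1)).2.2.2)).smul contDiffOn_const)).congr (RegularFamily.eqOn_fderivWithin hf x)
    exact_mod_cast contDiffOn_succ_of_fderivWithin
      (fun q hq => (RegularFamily.hasFDerivWithinAt hf x hq).differentiableWithinAt) (by simp) h

/-- Splitting off one differentiation, the derivative of order `k + 1` is the image of the
derivatives of order `k` of `dT f` and `dη f` under fixed continuous linear maps. -/
theorem RegularFamily.continuous_iteratedFDerivWithin (hf : ∀ n, RegularFamily n f) (k : ℕ) :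
    Continuous fun p : X × halfPlane =>
      iteratedFDerivWithin ℝ k (fun q : ℝ × ℝ => f p.1 q.1 q.2) halfPlane p.2 := by
  induction k generalizing f with
  | zero =>
    simp only [iteratedFDerivWithin_zero_eq_comp]
    exact (LinearIsometryEquiv.continuous _).comp
      ((hf 0).cont.continuous_comp (by fun_prop) (by fun_prop) (by fun_prop))
  | succ k ih =>
    let L : (ℝ × ℝ →L[ℝ] ℝ) → (ℝ →L[ℝ] ℝ × ℝ →L[ℝ] ℝ) := fun v =>
      (ContinuousLinearMap.id ℝ ℝ).smulRight v
    have hg : ∀ (g : X → ℝ → ℝ → ℝ) (v : ℝ × ℝ →L[ℝ] ℝ), (∀ n, RegularFamily n g) → ∀ x, ∀ q ∈ halfPlane,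
        iteratedFDerivWithin ℝ k (fun q : ℝ × ℝ => g x q.1 q.2 • v) halfPlane q =
        (L v).compContinuousMultilinearMap
          (iteratedFDerivWithin ℝ k (fun q : ℝ × ℝ => g x q.1 q.2) halfPlane q) := by
      intro g v hg x q hq
      exact (L v).iteratedFDerivWithin_comp_left (RegularFamily.contDiffOn hg x k q hq) uniqueDiffOn_halfPlane hq
        le_rfl
    have key : (fun p : X × halfPlane =>
        iteratedFDerivWithin ℝ (k + 1) (fun q : ℝ × ℝ => f p.1 q.1 q.2) halfPlane p.2) =
        fun p => (continuousMultilinearCurryRightEquiv' ℝ k (ℝ × ℝ) ℝ).symm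
          ((L (ContinuousLinearMap.fst ℝ ℝ ℝ)).compContinuousMultilinearMap
            (iteratedFDerivWithin ℝ k (fun q : ℝ × ℝ => dT f p.1 q.1 q.2) halfPlane p.2) +
          (L (ContinuousLinearMap.snd ℝ ℝ ℝ)).compContinuousMultilinearMap
            (iteratedFDerivWithin ℝ k (fun q : ℝ × ℝ => dη f p.1 q.1 q.2) halfPlane p.2)) := by
      funext p
      rw [iteratedFDerivWithin_succ_eq_comp_right uniqueDiffOn_halfPlane p.2.2,
        Function.comp_apply, iteratedFDerivWithin_congr (RegularFamily.eqOn_fderivWithin hf p.1) p.2.2 k]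
      have hadd := iteratedFDerivWithin_add_apply
        (f := fun q : ℝ × ℝ => dT f p.1 q.1 q.2 • ContinuousLinearMap.fst ℝ ℝ ℝ)
        (g := fun q : ℝ × ℝ => dη f p.1 q.1 q.2 • ContinuousLinearMap.snd ℝ ℝ ℝ)
        (((RegularFamily.contDiffOn (fun n => (hf (n + 1)).2.2.1) p.1 k).smul contDiffOn_const)
          _ p.2.2)
        (((RegularFamily.contDiffOn (fun n => (hf (n + 1)).2.2.2) p.1 k).smul contDiffOn_const)
          _ p.2.2)
        uniqueDiffOn_halfPlane p.2.2
      rw [hg _ _ (fun n => (hf (n + 1)).2.2.1) _ _ p.2.2,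
        hg _ _ (fun n => (hf (n + 1)).2.2.2) _ _ p.2.2] at hadd
      exact congrArg _ hadd
    rw [key]
    refine (LinearIsometryEquiv.continuous _).comp (Continuous.add ?_ ?_)
    · exact (ContinuousLinearMap.compContinuousMultilinearMapL ℝ (fun _ : Fin k => ℝ × ℝ) ℝ _
        (L _)).continuous.comp (ih (fun n => (hf (n + 1)).2.2.1))
    · exact (ContinuousLinearMap.compContinuousMultilinearMapL ℝ (fun _ : Fin k => ℝ × ℝ) ℝ _
        (L _)).continuous.comp (ih (fun n => (hf (n + 1)).2.2.2))

/-- The map to `C^∞(ℝ₊ × S¹)` given by a smooth family of functions of period `1` in `η`. -/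
noncomputable def RegularFamily.toMap (hf : ∀ n, RegularFamily n f)
    (hp : ∀ x t η, f x t (η + 1) = f x t η)
    (x : X) : smoothHalfCylinder :=
  ⟨SmoothSpace.mk (fun q : ℝ × ℝ => f x q.1 q.2)
    (contDiffOn_infty.2 fun k => RegularFamily.contDiffOn hf x k), fun t η => by
      by_cases ht : 0 ≤ t
      · rw [SmoothSpace.mk_ext _ _ (mem_halfPlane ht), SmoothSpace.mk_ext _ _ (mem_halfPlane ht)]
        exact hp x t η
      · have hn : ∀ η, (t, η) ∉ halfPlane := fun η h => ht h.1
        exact (extendZero_of_notMem _ (hn _)).trans (extendZero_of_notMem _ (hn _)).symm⟩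

theorem smoothHalfCylinder_ext {a b : smoothHalfCylinder}
    (h : ∀ q : halfPlane, a.1.toFun q = b.1.toFun q) : a = b :=
  Subtype.ext (SmoothSpace.toFun_injective (funext h))

/-- A jointly continuous function of parameter and point is continuous in the parameter for the
compact-open topology; this is applied to the derivatives of each order. -/
theorem RegularFamily.continuous_toMap (hf : ∀ n, RegularFamily n f)
    (hp : ∀ x t η, f x t (η + 1) = f x t η) : Continuous (RegularFamily.toMap hf hp) := by
  refine continuous_induced_rng.2 (SmoothSpace.continuous_iff.2 fun k => ?_)
  refine ContinuousMap.continuous_of_continuous_uncurry _ ?_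
  refine (RegularFamily.continuous_iteratedFDerivWithin hf k).congr fun p => ?_
  exact (iteratedFDerivWithin_congr (SmoothSpace.mk_ext (fun q : ℝ × ℝ => f p.1 q.1 q.2)
    (contDiffOn_infty.2 fun k => RegularFamily.contDiffOn hf p.1 k)) p.2.2 k).symm

end FamilyMaps

/-! ### Iterated directional derivatives of smooth families -/

section IteratedDerivatives

universe u

variable {X : Type u} [AddCommGroup X] [Module ℝ X] [TopologicalSpace X]
  {f : X → ℝ → ℝ → ℝ}

theorem SmoothFamily.regular (hf : SmoothFamily f) (n : ℕ) : RegularFamily n f := (hf n).regular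

theorem HasFamilyDerivs.dX_smul {X : Type u} [AddCommGroup X] [Module ℝ X] {f : X → ℝ → ℝ → ℝ}
    (hf : HasFamilyDerivs f) (x u : X) (c t η : ℝ) :
    dX f (x, c • u) t η = c * dX f (x, u) t η := by
  have h1 : HasDerivAt (fun s : ℝ => s * c) c 0 := by
    simpa using (hasDerivAt_id (0 : ℝ)).mul_const c
  have h2 : HasDerivAt (fun s : ℝ => f (x + s • u) t η) (dX f (x, u) t η) (0 * c) := by
    simpa using hf.hX x u t η
  refine (hf.hX x (c • u) t η).unique (((h2.comp 0 h1).congr_deriv (mul_comm _ _)).congr_of_eventuallyEq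
    (Filter.Eventually.of_forall fun s => ?_))
  simp [mul_smul]

/-- Directional derivatives need not be additive in general; continuity of `dX f` makes them so. The
function `(a, b) ↦ f (x + a u + b v)` has a total derivative at the origin, which is evaluated along
the diagonal. One-sided derivatives suffice, as they are unique on `[0, ∞)`. -/
theorem HasFamilyDerivs.dX_add [ContinuousAdd X] [ContinuousSMul ℝ X] (hf : HasFamilyDerivs f)
    (hc : ContFamily (dX f)) (x u v : X) (t η : ℝ) :
    dX f (x, u + v) t η = dX f (x, u) t η + dX f (x, v) t η := by
  have h1 := hasFDerivWithinAt_halfPlane_of_partial (t₀ := 0) (η₀ := 0) (a := dX f (x, u) t η)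
    (F := fun a b => f (x + a • u + b • v) t η)
    (F₂ := fun a b => dX f (x + a • u + b • v, v) t η)
    (by simpa using (hf.hX x u t η).hasDerivWithinAt)
    (fun a b _ => hf.hasDerivAt _ _ _ _ _)
    (Continuous.continuousWithinAt
      (hc.continuous_comp (by fun_prop) (by fun_prop) (by fun_prop)))
  have h2 : HasDerivWithinAt (fun s : ℝ => (s, s)) (1, 1) (Set.Ici 0) (0 : ℝ) :=
    ((hasDerivAt_id (0 : ℝ)).prodMk (hasDerivAt_id 0)).hasDerivWithinAt
  have h3 := h1.comp_hasDerivWithinAt (f := fun s : ℝ => (s, s)) 0 h2 (fun s hs => mem_halfPlane hs)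
  have h4 := (hf.hX x (u + v) t η).hasDerivWithinAt (s := Set.Ici 0)
  have h5 := (uniqueDiffOn_Ici (0 : ℝ) 0 Set.self_mem_Ici).eq_deriv _ h4
    (h3.congr_of_mem (fun s _ => by simp [add_assoc]) Set.self_mem_Ici)
  simpa using h5

/-- The `l`-th iterated directional derivative of a family. -/
noncomputable def iterDX (f : X → ℝ → ℝ → ℝ) : ∀ l : ℕ, X × (Fin l → X) → ℝ → ℝ → ℝ
  | 0 => fun p => f p.1
  | l + 1 => fun p => dX (iterDX f l) ((p.1, Fin.init p.2), (p.2 (Fin.last l), 0))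

/-- Each step is `dX` followed by a continuous linear substitution; the direction `(u_l, 0)` moves
the base point and keeps the earlier directions fixed. -/
theorem smoothFamily_iterDX (hf : SmoothFamily f) (l : ℕ) : SmoothFamily (iterDX f l) := by
  induction l with
  | zero => exact hf.comp_clm (ContinuousLinearMap.fst ℝ X (Fin 0 → X))
  | succ l ih =>
    let P := ContinuousLinearMap.fst ℝ X (Fin (l + 1) → X)
    let R := ContinuousLinearMap.snd ℝ X (Fin (l + 1) → X)
    exact ih.smooth_dX.comp_clm ((P.prod (ContinuousLinearMap.pi fun i : Fin l =>
      (ContinuousLinearMap.proj (R := ℝ) i.castSucc).comp R)).prod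
        (((ContinuousLinearMap.proj (R := ℝ) (Fin.last l)).comp R).prod 0))

theorem hasDerivAt_iterDX (hf : SmoothFamily f) (l : ℕ) (x h : X) (u : Fin l → X) (t η s : ℝ) :
    HasDerivAt (fun s : ℝ => iterDX f l (x + s • h, u) t η)
      (iterDX f (l + 1) (x + s • h, Fin.snoc (α := fun _ => X) u h) t η) s := by
  have := (smoothFamily_iterDX hf l).derivs.hasDerivAt (x, u) (h, 0) t η s
  simpa [iterDX] using this

/-- In the last slot this is additivity of `dX`; in an earlier slot the identity of order `l` is
differentiated in the base point. Symmetry of the derivatives is not involved. -/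
theorem iterDX_update_add [ContinuousAdd X] [ContinuousSMul ℝ X] (hf : SmoothFamily f) (l : ℕ)
    (x : X) (u : Fin l → X) (i : Fin l) (a b : X) (t η : ℝ) :
    iterDX f l (x, Function.update u i (a + b)) t η =
      iterDX f l (x, Function.update u i a) t η + iterDX f l (x, Function.update u i b) t η := by
  induction l generalizing x with
  | zero => exact i.elim0
  | succ l ih =>
    have hs := smoothFamily_iterDX hf l
    induction i using Fin.lastCases with
    | last =>
      simp only [iterDX, Fin.init_update_last, Function.update_self]
      rw [← hs.derivs.dX_add hs.smooth_dX.cont]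
      simp
    | cast j =>
      simp only [iterDX, Fin.init_update_castSucc,
        Function.update_of_ne (Fin.castSucc_lt_last j).ne']
      have h := fun w : Fin l → X => hs.derivs.hX (x, w) (u (Fin.last l), 0) t η
      simp only [Prod.smul_mk, smul_zero, Prod.mk_add_mk, add_zero] at h
      refine (h _).unique (((h _).add (h _)).congr_of_eventuallyEq
        (Filter.Eventually.of_forall fun s => ?_))
      exact ih _ _ _

theorem iterDX_update_smul (hf : SmoothFamily f) (l : ℕ)
    (x : X) (u : Fin l → X) (i : Fin l) (c : ℝ) (a : X) (t η : ℝ) :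
    iterDX f l (x, Function.update u i (c • a)) t η =
      c * iterDX f l (x, Function.update u i a) t η := by
  induction l generalizing x with
  | zero => exact i.elim0
  | succ l ih =>
    have hs := smoothFamily_iterDX hf l
    induction i using Fin.lastCases with
    | last =>
      simp only [iterDX, Fin.init_update_last, Function.update_self]
      rw [← hs.derivs.dX_smul]
      simp
    | cast j =>
      simp only [iterDX, Fin.init_update_castSucc,
        Function.update_of_ne (Fin.castSucc_lt_last j).ne']
      have h := fun w : Fin l → X => hs.derivs.hX (x, w) (u (Fin.last l), 0) t η
      simp only [Prod.smul_mk, smul_zero, Prod.mk_add_mk, add_zero] at h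
      refine (h _).unique (((h _).const_mul c).congr_of_eventuallyEq
        (Filter.Eventually.of_forall fun s => ?_))
      exact ih _ _ _

theorem iterDX_periodic (hp : ∀ x t η, f x t (η + 1) = f x t η) (l : ℕ)
    (p : X × (Fin l → X)) (t η : ℝ) : iterDX f l p t (η + 1) = iterDX f l p t η := by
  induction l with
  | zero => exact hp p.1 t η
  | succ l ih => simp only [iterDX, dX, ih]

/-- The integral of the `l + 1`-st derivative of a family over a segment `[x, x + v]`. -/
noncomputable def segmentAverage (f : X → ℝ → ℝ → ℝ) (l : ℕ) :
    X × X × (Fin (l + 1) → X) → ℝ → ℝ → ℝ :=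
  average fun p => iterDX f (l + 1) (p.1.1 + p.2 • p.1.2.1, p.1.2.2)

theorem segmentAverage_periodic (hp : ∀ x t η, f x t (η + 1) = f x t η)
    (l : ℕ) (p : X × X × (Fin (l + 1) → X)) (t η : ℝ) :
    segmentAverage f l p t (η + 1) = segmentAverage f l p t η := by
  simp only [segmentAverage, average, iterDX_periodic hp]

variable [IsTopologicalAddGroup X] [ContinuousSMul ℝ X]

theorem regularFamily_segmentAverage (hf : SmoothFamily f) (l n : ℕ) :
    RegularFamily n (segmentAverage f l) :=
  (((smoothFamily_iterDX hf (l + 1)) n).regular.comp_continuous (by fun_prop)).average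

/-- This is the fundamental theorem of calculus on `r ↦ x + r v`. The vector `v` enters twice, as
displacement and as last direction; `segmentAverage` keeps the two roles apart. -/
theorem iterDX_sub (hf : SmoothFamily f) (l : ℕ) (x v : X) (u : Fin l → X) (t η : ℝ) :
    iterDX f l (x + v, u) t η - iterDX f l (x, u) t η =
      segmentAverage f l (x, v, Fin.snoc (α := fun _ => X) u v) t η := by
  have hc : Continuous fun r : ℝ =>
      iterDX f (l + 1) (x + r • v, Fin.snoc (α := fun _ => X) u v) t η :=
    (smoothFamily_iterDX hf (l + 1)).cont.continuous_comp (by fun_prop) (by fun_prop) (by fun_prop)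
  have := intervalIntegral.integral_eq_sub_of_hasDerivAt
    (fun r _ => hasDerivAt_iterDX hf l x v u t η r) (hc.intervalIntegrable 0 1)
  simpa [segmentAverage, average] using this.symm

/-- Only the last direction is scaled, not the displacement. This permits extracting a scalar from
an increment. -/
theorem segmentAverage_smul (hf : SmoothFamily f) (l : ℕ) (x v h : X) (u : Fin l → X)
    (c t η : ℝ) :
    segmentAverage f l (x, v, Fin.snoc (α := fun _ => X) u (c • h)) t η =
      c * segmentAverage f l (x, v, Fin.snoc (α := fun _ => X) u h) t η := by
  have h1 : ∀ y, iterDX f (l + 1) (y, Fin.snoc (α := fun _ => X) u (c • h)) t η =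
      c * iterDX f (l + 1) (y, Fin.snoc (α := fun _ => X) u h) t η := fun y => by
    simp only [iterDX, Fin.init_snoc, Fin.snoc_last]
    rw [← (smoothFamily_iterDX hf l).derivs.dX_smul]
    simp
  simp only [segmentAverage, average, h1, intervalIntegral.integral_const_mul]

/-- The `l`-th derivative at a point, as a multilinear map. -/
noncomputable def SmoothFamily.multilinear (hf : SmoothFamily f)
    (hp : ∀ x t η, f x t (η + 1) = f x t η) (l : ℕ) (x : X) :
    ContinuousMultilinearMap ℝ (fun _ : Fin l => X) smoothHalfCylinder where
  toFun u := RegularFamily.toMap (smoothFamily_iterDX hf l).regular (iterDX_periodic hp l) (x, u)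
  map_update_add' := by
    intro inst u i a b
    obtain rfl := Subsingleton.elim inst (instDecidableEqFin l)
    refine smoothHalfCylinder_ext fun q => ?_
    exact iterDX_update_add hf l x u i a b q.1.1 q.1.2
  map_update_smul' := by
    intro inst u i c a
    obtain rfl := Subsingleton.elim inst (instDecidableEqFin l)
    refine smoothHalfCylinder_ext fun q => ?_
    exact iterDX_update_smul hf l x u i c a q.1.1 q.1.2
  cont := (RegularFamily.continuous_toMap (smoothFamily_iterDX hf l).regular
    (iterDX_periodic hp l)).comp (Continuous.prodMk_right x)

end IteratedDerivatives

/-- A smooth family of functions of period `1` in `η` defines a Keller smooth map. -/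
theorem SmoothFamily.kellerSmoothOn {X : Type*} [AddCommGroup X] [Module ℝ X] [TopologicalSpace X]
    [IsTopologicalAddGroup X] [ContinuousSMul ℝ X] [LocallyConvexSpace ℝ X] [T2Space X]
    {f : X → ℝ → ℝ → ℝ} (hf : SmoothFamily f) (hp : ∀ x t η, f x t (η + 1) = f x t η) :
    KellerSmoothOn (RegularFamily.toMap hf.regular hp) Set.univ := by
  set A : ∀ l, X × X × (Fin (l + 1) → X) → smoothHalfCylinder := fun l =>
    RegularFamily.toMap (regularFamily_segmentAverage hf l) (segmentAverage_periodic hp l)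
  have hA : ∀ l, Continuous (A l) := fun l => RegularFamily.continuous_toMap _ _
  have hsub : ∀ l x v u, hf.multilinear hp l (x + v) u - hf.multilinear hp l x u =
      A l (x, v, Fin.snoc (α := fun _ => X) u v) := fun l x v u =>
    smoothHalfCylinder_ext fun q => iterDX_sub hf l x v u q.1.1 q.1.2
  have hsmul : ∀ l x v h u (c : ℝ), A l (x, v, Fin.snoc (α := fun _ => X) u (c • h)) =
      c • A l (x, v, Fin.snoc (α := fun _ => X) u h) := fun l x v h u c =>
    smoothHalfCylinder_ext fun q => segmentAverage_smul hf l x v h u c q.1.1 q.1.2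
  refine ⟨isOpen_univ, hf.multilinear hp, fun x _ u => rfl, fun l x _ u h => ?_,
    fun l x _ W hW => ?_⟩
  -- By homogeneity in the last slot the difference quotient equals `A l (x, s • h, …, h)`, which is
  -- continuous also at `s = 0`.
  · have h1 : Continuous fun s : ℝ => A l (x, s • h, Fin.snoc (α := fun _ => X) u h) :=
      (hA l).comp (by fun_prop)
    have h2 : A l (x, (0 : ℝ) • h, Fin.snoc (α := fun _ => X) u h) =
        hf.multilinear hp (l + 1) x (Fin.snoc (α := fun _ => X) u h) :=
      smoothHalfCylinder_ext fun q => by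
        change segmentAverage f l (x, (0 : ℝ) • h, Fin.snoc (α := fun _ => X) u h) q.1.1 q.1.2 =
          iterDX f (l + 1) (x, Fin.snoc (α := fun _ => X) u h) q.1.1 q.1.2
        simp [segmentAverage, average]
    have h3 := (h1.tendsto 0).mono_left (nhdsWithin_le_nhds (s := {0}ᶜ))
    rw [h2] at h3
    refine h3.congr' ?_
    filter_upwards [self_mem_nhdsWithin] with s hs
    rw [hsub, hsmul, smul_smul, inv_mul_cancel₀ hs, one_smul]
  -- `A l (x, ·)` is continuous and vanishes at the origin, so it maps a product of
  -- zero-neighbourhoods into `W`: `U₁` for the displacement, `U₂` for the last direction, `U₃` for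
  -- the others. None of them depends on `ε`.
  · have h0 : A l (x, 0, Fin.snoc (α := fun _ => X) (fun _ : Fin l => (0 : X)) 0) = 0 := by
      have := hsmul l x 0 0 (fun _ => 0) 0
      simpa using this
    have hc : Continuous fun p : X × X × (Fin l → X) =>
        A l (x, p.1, Fin.snoc (α := fun _ => X) p.2.2 p.2.1) := by
      refine (hA l).comp (continuous_const.prodMk (continuous_fst.prodMk ?_))
      fun_prop
    have hW' : ∀ᶠ p in 𝓝 ((0, 0, fun _ => 0) : X × X × (Fin l → X)),
        A l (x, p.1, Fin.snoc (α := fun _ => X) p.2.2 p.2.1) ∈ W := by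
      refine hc.continuousAt.eventually ?_
      simpa [h0] using hW
    rw [nhds_prod_eq, nhds_prod_eq] at hW'
    obtain ⟨U₁, hU₁, S, hS, h1⟩ := Filter.mem_prod_iff.1 hW'
    obtain ⟨U₂, hU₂, S₃, hS₃, h2⟩ := Filter.mem_prod_iff.1 hS
    rw [nhds_pi, Filter.mem_pi'] at hS₃
    obtain ⟨I, U₃, hU₃, h3⟩ := hS₃
    refine ⟨U₂ ∩ ⋂ i ∈ I, U₃ i, Filter.inter_mem hU₂
      ((Filter.biInter_finset_mem I).2 fun i _ => hU₃ i), fun ε hε => ?_⟩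
    -- `V = U₁ ∩ ε U₂`: the displacement stays `v`, while the last direction is written as `ε • (ε⁻¹
    -- • v)` with `ε⁻¹ • v ∈ U₂`.
    refine ⟨U₁ ∩ (fun v => ε⁻¹ • v) ⁻¹' U₂, Filter.inter_mem hU₁ ?_, fun v hv u hu => ?_⟩
    · have : ContinuousAt (fun v : X => ε⁻¹ • v) 0 := by fun_prop
      exact this.preimage_mem_nhds (by simpa using hU₂)
    · rw [hsub]
      have e : v = ε • (ε⁻¹ • v) := by rw [smul_smul, mul_inv_cancel₀ hε.ne', one_smul]
      conv in (occs := 2) v => rw [e]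
      rw [hsmul]
      refine Set.smul_mem_smul_set (h1 (Set.mk_mem_prod hv.1 (h2 (Set.mk_mem_prod hv.2 (h3 ?_)))))
      intro i hi
      exact Set.mem_iInter₂.1 (hu i).2 i hi

/-! ### Scalar ordinary differential equations -/

/-- Comparison of solutions of two differential equations that are close to each other near one of
the solutions. -/
theorem abs_sub_le_of_perturbed_ode {T L δ : ℝ} {f g : ℝ → ℝ → ℝ} {y z : ℝ → ℝ}
    (hy : ∀ t ∈ Set.Icc 0 T, HasDerivWithinAt y (f t (y t)) (Set.Icc 0 T) t)
    (hz : ∀ t ∈ Set.Icc 0 T, HasDerivWithinAt z (g t (z t)) (Set.Icc 0 T) t)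
    (hL : ∀ t ∈ Set.Icc 0 T, ∀ ξ, |ξ - y t| ≤ 1 → |f t ξ - f t (y t)| ≤ L * |ξ - y t|)
    (hg : ∀ t ∈ Set.Icc 0 T, ∀ ξ, |ξ - y t| ≤ 1 → |g t ξ - f t ξ| < δ)
    (h0 : |z 0 - y 0| ≤ δ) (hL0 : 0 ≤ L) (hδ0 : 0 < δ) (hδ : δ * Real.exp ((L + 1) * T) ≤ 1) :
    ∀ t ∈ Set.Icc 0 T, |z t - y t| ≤ δ * Real.exp ((L + 1) * t) := by
  have hexp : ∀ t, HasDerivAt (fun t => δ * Real.exp ((L + 1) * t))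
      ((L + 1) * (δ * Real.exp ((L + 1) * t))) t := fun t => by
    have := (((hasDerivAt_id t).const_mul (L + 1)).exp).const_mul δ
    refine this.congr_deriv ?_
    simp only [id, mul_one]
    ring
  -- Barrier argument: where `|z - y|` meets the barrier `b = δ e^{(L+1)t}`, one has `δ ≤ b ≤ 1`. So
  -- `z` lies in the tube where the hypotheses apply, and the derivative of `z - y` is less than `δ
  -- + L b ≤ (L + 1) b = b'` in absolute value.
  refine image_norm_le_of_norm_deriv_right_lt_deriv_boundary (f := fun t => z t - y t)
    (f' := fun t => g t (z t) - f t (y t))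
    (fun t ht => ((hz t ht).sub (hy t ht)).continuousWithinAt) (fun t ht => ?_)
    (by simpa using h0) hexp (fun t ht hb => ?_)
  · exact ((hz t ⟨ht.1, ht.2.le⟩).sub (hy t ⟨ht.1, ht.2.le⟩)).mono_of_mem_nhdsWithin
      (Icc_mem_nhdsGE_of_mem ht)
  · have hT : t ∈ Set.Icc 0 T := ⟨ht.1, ht.2.le⟩
    rw [Real.norm_eq_abs] at hb ⊢
    have h1 : |z t - y t| ≤ 1 := by
      rw [hb]
      refine le_trans ?_ hδ
      gcongr
      exact ht.2.le
    have h2 : δ ≤ |z t - y t| := by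
      rw [hb]
      exact le_mul_of_one_le_right hδ0.le (Real.one_le_exp (by have := ht.1; positivity))
    rw [← hb]
    have h3 := hL t hT _ h1
    have h4 := hg t hT _ h1
    calc |g t (z t) - f t (y t)| = |(g t (z t) - f t (z t)) + (f t (z t) - f t (y t))| := by ring_nf
      _ ≤ |g t (z t) - f t (z t)| + |f t (z t) - f t (y t)| := abs_add_le _ _
      _ < (L + 1) * |z t - y t| := by linarith

/-- The variation of constants formula. -/
theorem eq_of_linear_ode {α β d : ℝ → ℝ} (hα : Continuous α) (hβ : Continuous β)
    (hd : ∀ t, 0 ≤ t → HasDerivWithinAt d (α t + β t * d t) (Set.Ici 0) t) {t : ℝ} (ht : 0 ≤ t) :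
    d t = Real.exp (∫ τ in (0 : ℝ)..t, β τ) *
      (d 0 + ∫ τ in (0 : ℝ)..t, Real.exp (-∫ σ in (0 : ℝ)..τ, β σ) * α τ) := by
  have hP : ∀ t, HasDerivAt (fun t => ∫ τ in (0 : ℝ)..t, β τ) (β t) t := fun t =>
    intervalIntegral.integral_hasDerivAt_right (hβ.intervalIntegrable _ _)
      (hβ.stronglyMeasurableAtFilter _ _) hβ.continuousAt
  have hPc : Continuous fun t => ∫ τ in (0 : ℝ)..t, β τ :=
    continuous_iff_continuousAt.2 fun t => (hP t).continuousAt
  have hc : Continuous fun τ => Real.exp (-∫ σ in (0 : ℝ)..τ, β σ) * α τ := by fun_prop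
  have hI : ∀ t, HasDerivAt (fun t => ∫ τ in (0 : ℝ)..t, Real.exp (-∫ σ in (0 : ℝ)..τ, β σ) * α τ)
      (Real.exp (-∫ σ in (0 : ℝ)..t, β σ) * α t) t := fun t =>
    intervalIntegral.integral_hasDerivAt_right (hc.intervalIntegrable _ _)
      (hc.stronglyMeasurableAtFilter _ _) hc.continuousAt
  -- With the integrating factor, the difference of the two sides has derivative zero.
  have hh : ∀ s, 0 ≤ s → HasDerivWithinAt (fun s => Real.exp (-∫ σ in (0 : ℝ)..s, β σ) * d s -
      ∫ τ in (0 : ℝ)..s, Real.exp (-∫ σ in (0 : ℝ)..τ, β σ) * α τ) 0 (Set.Ici 0) s := fun s hs => by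
    refine (((hP s).neg.exp.hasDerivWithinAt.mul (hd s hs)).sub
      (hI s).hasDerivWithinAt).congr_deriv ?_
    simp only [Pi.neg_apply]
    ring
  have h := constant_of_has_deriv_right_zero
    (fun s hs => ((hh s hs.1).mono Set.Icc_subset_Ici_self).continuousWithinAt)
    (fun s hs => (hh s hs.1).mono (Set.Ici_subset_Ici.2 hs.1)) t (Set.right_mem_Icc.2 ht)
  simp only [intervalIntegral.integral_same, neg_zero, Real.exp_zero, one_mul, sub_zero] at h
  rw [← h, sub_add_cancel, ← mul_assoc, ← Real.exp_add, add_neg_cancel, Real.exp_zero, one_mul]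

/-- Hadamard's lemma. The integral form keeps the quotient continuous even where `a = b`. -/
theorem sub_eq_mul_integral {g g' : ℝ → ℝ} (hg : ∀ x, HasDerivAt g (g' x) x) (hc : Continuous g')
    (a b : ℝ) : g b - g a = (∫ r in (0 : ℝ)..1, g' (a + r * (b - a))) * (b - a) := by
  have h : ∀ r, HasDerivAt (fun r => g (a + r * (b - a))) (g' (a + r * (b - a)) * (b - a)) r :=
    fun r => (hg _).comp r (by
      simpa using ((hasDerivAt_id r).mul_const (b - a)).const_add a)
  have := intervalIntegral.integral_eq_sub_of_hasDerivAt (fun r _ => h r)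
    (Continuous.intervalIntegrable (by fun_prop) 0 1)
  rw [intervalIntegral.integral_mul_const] at this
  simpa using this.symm

/-- Differentiability of the solution of a scalar differential equation in a parameter. -/
theorem hasDerivAt_solution_of_parameter {Y : ℝ → ℝ → ℝ} {Φ Φs : ℝ → ℝ → ℝ → ℝ} {Φξ : ℝ → ℝ → ℝ}
    {a' : ℝ} (hY : Continuous Y.uncurry)
    (hode : ∀ s t, 0 ≤ t → HasDerivWithinAt (Y s) (Φ s t (Y s t)) (Set.Ici 0) t)
    (hΦs : ∀ s t ξ, HasDerivAt (fun s => Φ s t ξ) (Φs s t ξ) s)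
    (hΦξ : ∀ t ξ, HasDerivAt (Φ 0 t) (Φξ t ξ) ξ)
    (hcs : Continuous fun p : ℝ × ℝ × ℝ => Φs p.1 p.2.1 p.2.2) (hcξ : Continuous Φξ.uncurry)
    (h0 : HasDerivAt (fun s => Y s 0) a' 0) {t : ℝ} (ht : 0 ≤ t) :
    HasDerivAt (fun s => Y s t) (Real.exp (∫ τ in (0 : ℝ)..t, Φξ τ (Y 0 τ)) *
      (a' + ∫ τ in (0 : ℝ)..t, Real.exp (-∫ σ in (0 : ℝ)..τ, Φξ σ (Y 0 σ)) * Φs 0 τ (Y 0 τ))) 0 := by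
  -- Hadamard factors of `Φ s τ (Y s τ) - Φ 0 τ (Y 0 τ)`: first `s` is moved at the fixed value `Y s
  -- τ`, then the value is moved at `s = 0`. Thus `Y s - Y 0` satisfies exactly a linear equation
  -- with source `s α` and coefficient `β`.
  set α : ℝ → ℝ → ℝ := fun s τ => ∫ r in (0 : ℝ)..1, Φs (r * s) τ (Y s τ) with hα
  set β : ℝ → ℝ → ℝ := fun s τ => ∫ r in (0 : ℝ)..1, Φξ τ (Y 0 τ + r * (Y s τ - Y 0 τ)) with hβ
  have hY' : ∀ {Z : Type} [TopologicalSpace Z] {a b : Z → ℝ}, Continuous a → Continuous b →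
      Continuous fun z => Y (a z) (b z) := fun ha hb => hY.comp (ha.prodMk hb)
  have hαc : Continuous α.uncurry := by
    refine intervalIntegral.continuous_parametric_intervalIntegral_of_continuous'
      (f := fun (p : ℝ × ℝ) r => Φs (r * p.1) p.2 (Y p.1 p.2)) ?_ 0 1
    exact hcs.comp (f := fun q : (ℝ × ℝ) × ℝ => (q.2 * q.1.1, q.1.2, Y q.1.1 q.1.2))
      ((by fun_prop : Continuous fun q : (ℝ × ℝ) × ℝ => q.2 * q.1.1).prodMk
        ((by fun_prop : Continuous fun q : (ℝ × ℝ) × ℝ => q.1.2).prodMk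
          (hY' (by fun_prop) (by fun_prop))))
  have hβc : Continuous β.uncurry := by
    refine intervalIntegral.continuous_parametric_intervalIntegral_of_continuous'
      (f := fun (p : ℝ × ℝ) r => Φξ p.2 (Y 0 p.2 + r * (Y p.1 p.2 - Y 0 p.2))) ?_ 0 1
    have h1 : Continuous fun q : (ℝ × ℝ) × ℝ => Y 0 q.1.2 := hY' (by fun_prop) (by fun_prop)
    have h2 : Continuous fun q : (ℝ × ℝ) × ℝ => Y q.1.1 q.1.2 := hY' (by fun_prop) (by fun_prop)
    exact hcξ.comp (f := fun q : (ℝ × ℝ) × ℝ =>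
      (q.1.2, Y 0 q.1.2 + q.2 * (Y q.1.1 q.1.2 - Y 0 q.1.2))) (by fun_prop)
  have hα' : ∀ s, Continuous (α s) := fun s => hαc.comp (Continuous.prodMk_right s)
  have hβ' : ∀ s, Continuous (β s) := fun s => hβc.comp (Continuous.prodMk_right s)
  have hd : ∀ s τ, 0 ≤ τ → HasDerivWithinAt (fun τ => Y s τ - Y 0 τ)
      (s * α s τ + β s τ * (Y s τ - Y 0 τ)) (Set.Ici 0) τ := fun s τ hτ => by
    refine ((hode s τ hτ).sub (hode 0 τ hτ)).congr_deriv ?_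
    have e1 := sub_eq_mul_integral (g := fun r => Φ r τ (Y s τ)) (fun r => hΦs r τ (Y s τ))
      (hcs.comp (by fun_prop : Continuous fun r : ℝ => (r, τ, Y s τ))) 0 s
    have e2 := sub_eq_mul_integral (hΦξ τ)
      (hcξ.comp (by fun_prop : Continuous fun r : ℝ => (τ, r))) (Y 0 τ) (Y s τ)
    simp only [zero_add, sub_zero] at e1
    simp only [hα, hβ]
    rw [← e2, mul_comm s, ← e1]
    ring
  have hsol := fun s => eq_of_linear_ode ((hα' s).const_mul s) (hβ' s) (hd s) ht
  have hP : Continuous fun p : ℝ × ℝ => ∫ σ in (0 : ℝ)..p.2, β p.1 σ :=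
    intervalIntegral.continuous_parametric_intervalIntegral_of_continuous
      (f := fun (p : ℝ × ℝ) σ => β p.1 σ)
      (hβc.comp (by fun_prop : Continuous fun q : (ℝ × ℝ) × ℝ => (q.1.1, q.2))) continuous_snd
  have hE : Continuous fun s => Real.exp (∫ σ in (0 : ℝ)..t, β s σ) :=
    Real.continuous_exp.comp (hP.comp (Continuous.prodMk_left t))
  have hG : Continuous fun s => ∫ τ in (0 : ℝ)..t,
      Real.exp (-∫ σ in (0 : ℝ)..τ, β s σ) * α s τ :=
    intervalIntegral.continuous_parametric_intervalIntegral_of_continuous'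
      (f := fun s τ => Real.exp (-∫ σ in (0 : ℝ)..τ, β s σ) * α s τ)
      ((Real.continuous_exp.comp hP.neg).mul hαc) 0 t
  have hβ0 : β 0 = fun τ => Φξ τ (Y 0 τ) := by
    funext τ
    simp [hβ]
  have hα0 : α 0 = fun τ => Φs 0 τ (Y 0 τ) := by
    funext τ
    simp [hα]
  -- The explicit formula for `Y s t - Y 0 t`, divided by `s`, is the slope of the initial values
  -- plus terms continuous in `s`; the limit is obtained by setting `s = 0` in these.
  rw [hasDerivAt_iff_tendsto_slope_zero] at h0 ⊢
  have hlim := ((hE.tendsto 0).mono_left (nhdsWithin_le_nhds (s := {0}ᶜ))).mul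
    (h0.add ((hG.tendsto 0).mono_left (nhdsWithin_le_nhds (s := {0}ᶜ))))
  simp only [hβ0, hα0] at hlim
  refine hlim.congr' ?_
  filter_upwards [self_mem_nhdsWithin] with s hs
  have hs' : s ≠ 0 := hs
  have h1 := hsol s
  have h2 : ∫ τ in (0 : ℝ)..t, Real.exp (-∫ σ in (0 : ℝ)..τ, β s σ) * (s * α s τ) =
      s * ∫ τ in (0 : ℝ)..t, Real.exp (-∫ σ in (0 : ℝ)..τ, β s σ) * α s τ := by
    rw [← intervalIntegral.integral_const_mul]
    congr 1
    funext τ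
    ring
  rw [h2] at h1
  simp only [zero_add, smul_eq_mul]
  rw [h1]
  field_simp

/-! ### Solutions along the characteristics -/

theorem SmoothSpace.hasDerivAt_snd (φ : SmoothSpace halfSpace) {t : ℝ} (ht : 0 ≤ t) (η ξ : ℝ) :
    HasDerivAt (fun ξ => φ.ext (t, η, ξ))
      ((SmoothSpace.dirDeriv halfSpace (0, 0, 1) φ).ext (t, η, ξ)) ξ := by
  have hγ : HasDerivAt (fun ξ : ℝ => (t, η, ξ)) (0, 0, 1) ξ :=
    (hasDerivAt_const _ _).prodMk ((hasDerivAt_const _ _).prodMk (hasDerivAt_id _))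
  simpa using φ.hasDerivAt_comp hγ fun _ => mem_halfSpace ht

theorem SmoothSpace.hasDerivAt_fst (φ : SmoothSpace halfSpace) {t : ℝ} (ht : 0 ≤ t) (η ξ : ℝ) :
    HasDerivAt (fun η => φ.ext (t, η, ξ))
      ((SmoothSpace.dirDeriv halfSpace (0, 1, 0) φ).ext (t, η, ξ)) η := by
  have hγ : HasDerivAt (fun η : ℝ => (t, η, ξ)) (0, 1, 0) η :=
    (hasDerivAt_const _ _).prodMk ((hasDerivAt_id _).prodMk (hasDerivAt_const _ _))
  simpa using φ.hasDerivAt_comp hγ fun _ => mem_halfSpace ht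

/-- Smooth functions are bounded along characteristics, for bounded values of `t` and `ξ`. -/
theorem SmoothSpace.exists_bound (φ : SmoothSpace halfSpace) (c T R : ℝ) :
    ∃ C, 0 ≤ C ∧ ∀ t ∈ Set.Icc 0 T, ∀ ξ, |ξ| ≤ R → |φ.ext (t, c + t, ξ)| ≤ C := by
  have hc : Continuous fun p : ℝ × ℝ => φ.ext (max p.1 0, c + p.1, p.2) :=
    continuous_ext_halfSpace (μ := fun _ => φ) continuous_const continuous_fst (by fun_prop)
      continuous_snd
  obtain ⟨C, hC⟩ := ((isCompact_Icc (a := (0 : ℝ)) (b := T)).prod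
    (isCompact_Icc (a := -R) (b := R))).exists_bound_of_continuousOn hc.continuousOn
  refine ⟨max C 0, le_max_right _ _, fun t ht ξ hξ => le_max_of_le_left ?_⟩
  simpa [max_eq_left ht.1] using hC (t, ξ) ⟨ht, abs_le.1 hξ⟩

theorem SmoothSpace.exists_lipschitz (φ : SmoothSpace halfSpace) (c T R : ℝ) :
    ∃ L, 0 ≤ L ∧ ∀ t ∈ Set.Icc 0 T, ∀ ξ ζ, |ξ| ≤ R → |ζ| ≤ R →
      |φ.ext (t, c + t, ξ) - φ.ext (t, c + t, ζ)| ≤ L * |ξ - ζ| := by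
  obtain ⟨L, hL0, hL⟩ := (SmoothSpace.dirDeriv halfSpace (0, 0, 1) φ).exists_bound c T R
  refine ⟨L, hL0, fun t ht ξ ζ hξ hζ => ?_⟩
  exact (convex_Icc (-R) R).norm_image_sub_le_of_norm_hasDerivWithin_le
    (fun ξ _ => (φ.hasDerivAt_snd ht.1 (c + t) ξ).hasDerivWithinAt)
    (fun ξ hξ => hL t ht ξ (abs_le.2 hξ)) (abs_le.1 hζ) (abs_le.1 hξ)

/-- A smooth `φ` is Lipschitz in `ξ` on bounded sets, and the tube of radius `1` about a continuous
`y` over `[0, T]` is bounded. The comparison theorem asks for no more. -/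
theorem SmoothSpace.exists_lipschitz_near (φ : SmoothSpace halfSpace) (c T : ℝ) {y : ℝ → ℝ}
    (hy : ContinuousOn y (Set.Icc 0 T)) :
    ∃ R L, 0 ≤ L ∧ (∀ t ∈ Set.Icc 0 T, ∀ ξ, |ξ - y t| ≤ 1 → |ξ| ≤ R) ∧
      ∀ t ∈ Set.Icc 0 T, ∀ ξ, |ξ - y t| ≤ 1 →
        |φ.ext (t, c + t, ξ) - φ.ext (t, c + t, y t)| ≤ L * |ξ - y t| := by
  obtain ⟨R, hR⟩ := isCompact_Icc.exists_bound_of_continuousOn hy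
  obtain ⟨L, hL0, hL⟩ := φ.exists_lipschitz c T (R + 1)
  have h : ∀ t ∈ Set.Icc 0 T, ∀ ξ, |ξ - y t| ≤ 1 → |ξ| ≤ R + 1 := fun t ht ξ hξ => by
    have h1 := hR t ht
    rw [Real.norm_eq_abs] at h1
    have h2 := abs_add_le (ξ - y t) (y t)
    rw [sub_add_cancel] at h2
    linarith
  exact ⟨R + 1, L, hL0, h, fun t ht ξ hξ => hL t ht _ _ (h t ht ξ hξ)
    (h t ht (y t) (by simp))⟩

/-- The equation is compared with itself, with `δ` arbitrarily small; `δ` is scaled so that the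
final bound is `min 1 ε`. -/
theorem eq_of_characteristic_ode (φ : SmoothSpace halfSpace) (c : ℝ) {T : ℝ} {y z : ℝ → ℝ}
    (hy : ∀ t ∈ Set.Icc 0 T, HasDerivWithinAt y (φ.ext (t, c + t, y t)) (Set.Icc 0 T) t)
    (hz : ∀ t ∈ Set.Icc 0 T, HasDerivWithinAt z (φ.ext (t, c + t, z t)) (Set.Icc 0 T) t)
    (h0 : z 0 = y 0) {t : ℝ} (ht : t ∈ Set.Icc 0 T) : z t = y t := by
  obtain ⟨R, L, hL0, -, hL⟩ := φ.exists_lipschitz_near c T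
    (fun t ht => (hy t ht).continuousWithinAt)
  have hE : 0 < Real.exp ((L + 1) * T) := Real.exp_pos _
  refine eq_of_abs_sub_le_all fun ε hε => ?_
  set δ := min 1 ε * (Real.exp ((L + 1) * T))⁻¹ with hδ
  have hδ0 : 0 < δ := by positivity
  have hδ1 : δ * Real.exp ((L + 1) * T) = min 1 ε := by
    rw [hδ, mul_assoc, inv_mul_cancel₀ hE.ne', mul_one]
  have := abs_sub_le_of_perturbed_ode (f := fun t ξ => φ.ext (t, c + t, ξ))
    (g := fun t ξ => φ.ext (t, c + t, ξ)) hy hz hL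
    (fun t _ ξ _ => by simpa using hδ0) (by simpa [h0] using hδ0.le) hL0 hδ0
    (hδ1 ▸ min_le_left _ _) t ht
  calc |z t - y t| ≤ δ * Real.exp ((L + 1) * t) := this
    _ ≤ δ * Real.exp ((L + 1) * T) := by
      gcongr
      exact ht.2
    _ ≤ ε := hδ1 ▸ min_le_right _ _

/-- Vanishing of `φ` for `|ξ| ≥ M` gives a bound `C` for all `ξ`, so no solution leaves the ball of
radius `C T` about `a`, and Picard–Lindelöf works on all of `[0, T]` without continuation. -/
theorem exists_characteristic_solution_Icc (φ : nonlinearitySpace) (c a : ℝ) {T : ℝ} (hT : 0 ≤ T) :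
    ∃ y : ℝ → ℝ, y 0 = a ∧
      ∀ t ∈ Set.Icc 0 T, HasDerivWithinAt y (φ.1.ext (t, c + t, y t)) (Set.Icc 0 T) t := by
  obtain ⟨M, hM⟩ := φ.2.2 T hT
  obtain ⟨C, hC0, hC⟩ := φ.1.exists_bound c T M
  have hC' : ∀ t ∈ Set.Icc 0 T, ∀ ξ, |φ.1.ext (t, c + t, ξ)| ≤ C := fun t ht ξ => by
    rcases le_total |ξ| M with h | h
    · exact hC t ht ξ h
    · rw [hM t _ ξ ht.1 ht.2 h, abs_zero]
      exact hC0
  obtain ⟨L, hL0, hL⟩ := φ.1.exists_lipschitz c T (|a| + C * T)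
  have hpl : IsPicardLindelof (fun t ξ => φ.1.ext (t, c + t, ξ)) (tmin := 0) (tmax := T)
      ⟨0, le_rfl, hT⟩ a (C * T).toNNReal 0 C.toNNReal L.toNNReal := by
    refine ⟨fun t ht => ?_, fun ξ _ => ?_, fun t ht ξ _ => ?_, ?_⟩
    · have hb : ∀ ξ ∈ Metric.closedBall a ((C * T).toNNReal : ℝ), |ξ| ≤ |a| + C * T := fun ξ hξ => by
        rw [Real.coe_toNNReal _ (by positivity), Metric.mem_closedBall, Real.dist_eq] at hξ
        have h2 := abs_add_le (ξ - a) a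
        rw [sub_add_cancel] at h2
        linarith
      refine LipschitzOnWith.of_dist_le_mul fun ξ hξ ζ hζ => ?_
      rw [Real.coe_toNNReal _ hL0]
      exact hL t ht ξ ζ (hb ξ hξ) (hb ζ hζ)
    · have hc : Continuous fun t : ℝ => φ.1.ext (max t 0, c + t, ξ) :=
        continuous_ext_halfSpace (μ := fun _ => φ.1) continuous_const continuous_id (by fun_prop)
          continuous_const
      exact hc.continuousOn.congr fun t ht => by simp [max_eq_left ht.1]
    · rw [Real.coe_toNNReal _ hC0]
      exact hC' t ht ξ
    · rw [Real.coe_toNNReal _ hC0, Real.coe_toNNReal _ (by positivity)]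
      simp [max_eq_left hT]
  exact hpl.exists_eq_forall_mem_Icc_hasDerivWithinAt₀

theorem exists_characteristic_solution (φ : nonlinearitySpace) (c a : ℝ) :
    ∃ y : ℝ → ℝ, y 0 = a ∧
      ∀ t, 0 ≤ t → HasDerivWithinAt y (φ.1.ext (t, c + t, y t)) (Set.Ici 0) t := by
  choose Y hY0 hY using fun n : ℕ => exists_characteristic_solution_Icc φ c a n.cast_nonneg
  have hle : ∀ t : ℝ, t ≤ (⌈t⌉₊ + 1 : ℕ) := fun t => by
    push_cast
    linarith [Nat.le_ceil t]
  have heq : ∀ (m n : ℕ) (t : ℝ), 0 ≤ t → t ≤ m → t ≤ n → Y m t = Y n t := fun m n t h0 hm hn => by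
    refine eq_of_characteristic_ode φ.1 c (T := t) (fun s hs => ?_) (fun s hs => ?_)
      ((hY0 m).trans (hY0 n).symm) (Set.right_mem_Icc.2 h0)
    · exact (hY n s ⟨hs.1, hs.2.trans hn⟩).mono (Set.Icc_subset_Icc_right hn)
    · exact (hY m s ⟨hs.1, hs.2.trans hm⟩).mono (Set.Icc_subset_Icc_right hm)
  -- The `+ 1` puts `t` strictly below the end of its interval, so that this interval is a
  -- neighbourhood of `t` in `[0, ∞)`.
  refine ⟨fun t => Y (⌈t⌉₊ + 1) t, hY0 _, fun t ht => ?_⟩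
  have hlt : t < (⌈t⌉₊ + 1 : ℕ) := by
    push_cast
    linarith [Nat.le_ceil t]
  have hmem : Set.Icc (0 : ℝ) (⌈t⌉₊ + 1 : ℕ) ∈ 𝓝[Set.Ici 0] t :=
    Filter.mem_of_superset (inter_mem_nhdsWithin _ (Iio_mem_nhds hlt))
      fun s hs => ⟨hs.1, le_of_lt hs.2⟩
  refine ((hY (⌈t⌉₊ + 1) t ⟨ht, hle t⟩).mono_of_mem_nhdsWithin hmem).congr_of_eventuallyEq ?_ rfl
  filter_upwards [hmem] with s hs
  exact heq _ _ s hs.1 (hle s) hs.2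

/-- The solution of the initial value problem on the characteristic through `(0, c)`. -/
noncomputable def characteristicSolution (x : DataSpace) (c : ℝ) : ℝ → ℝ :=
  (exists_characteristic_solution x.2 c (x.1.1.ext c)).choose

theorem characteristicSolution_zero (x : DataSpace) (c : ℝ) :
    characteristicSolution x c 0 = x.1.1.ext c :=
  (exists_characteristic_solution x.2 c (x.1.1.ext c)).choose_spec.1

theorem hasDerivWithinAt_characteristicSolution (x : DataSpace) (c : ℝ) {t : ℝ} (ht : 0 ≤ t) :
    HasDerivWithinAt (characteristicSolution x c)
      (x.2.1.ext (t, c + t, characteristicSolution x c t)) (Set.Ici 0) t :=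
  (exists_characteristic_solution x.2 c (x.1.1.ext c)).choose_spec.2 t ht

/-- For data and characteristic near `(x, c)` the equations are uniformly close on the compact set
`[0, T] × [-R, R]` containing the unit tube about the given solution, so the comparison theorem
applies. Variation of the time is covered by continuity of that one solution. -/
theorem continuous_characteristicSolution :
    Continuous fun p : DataSpace × ℝ × ℝ => characteristicSolution p.1 p.2.1 (max p.2.2 0) := by
  rw [continuous_iff_continuousAt]
  rintro ⟨x, c, t₀⟩
  set y := characteristicSolution x c with hy
  set T := max t₀ 0 + 1 with hT
  have hode : ∀ x c, ∀ t ∈ Set.Icc 0 T, HasDerivWithinAt (characteristicSolution x c)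
      (x.2.1.ext (t, c + t, characteristicSolution x c t)) (Set.Icc 0 T) t := fun x c t ht =>
    (hasDerivWithinAt_characteristicSolution x c ht.1).mono Set.Icc_subset_Ici_self
  obtain ⟨R, L, hL0, hR, hL⟩ := x.2.1.exists_lipschitz_near c T
    (fun t ht => (hode x c t ht).continuousWithinAt)
  have hE : 0 < Real.exp ((L + 1) * T) := Real.exp_pos _
  have hyc : ContinuousAt (fun t => y (max t 0)) t₀ := by
    have h : ContinuousOn y (Set.Ici 0) := fun t ht =>
      (hasDerivWithinAt_characteristicSolution x c ht).continuousWithinAt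
    exact (h.comp_continuous (by fun_prop) fun t => le_max_right t 0).continuousAt
  refine Metric.tendsto_nhds.2 fun ε hε => ?_
  set δ := min 1 (ε / 2) * (Real.exp ((L + 1) * T))⁻¹ with hδ
  have hδ0 : 0 < δ := by positivity
  have hδ1 : δ * Real.exp ((L + 1) * T) = min 1 (ε / 2) := by
    rw [hδ, mul_assoc, inv_mul_cancel₀ hE.ne', mul_one]
  have hmul : Continuous fun x : DataSpace => x.2.1 := continuous_subtype_val.comp continuous_snd
  have hinl : Continuous fun x : DataSpace => x.1.1 := continuous_subtype_val.comp continuous_fst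
  have h1 : ∀ᶠ p : DataSpace × ℝ × ℝ in 𝓝 (x, c, t₀), |p.1.1.1.ext p.2.1 - x.1.1.ext c| < δ := by
    have : Continuous fun p : DataSpace × ℝ × ℝ => p.1.1.1.ext p.2.1 :=
      continuous_ext_univ (hinl.comp continuous_fst) (by fun_prop)
    exact Metric.tendsto_nhds.1 (this.tendsto _) δ hδ0
  have h2 : ∀ᶠ p : DataSpace × ℝ × ℝ in 𝓝 (x, c, t₀), ∀ q ∈ Set.Icc 0 T ×ˢ Set.Icc (-R) R,
      |p.1.2.1.ext (max q.1 0, p.2.1 + q.1, q.2) - x.2.1.ext (max q.1 0, c + q.1, q.2)| < δ := by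
    -- Uniform closeness comes from compactness and joint continuity of evaluation; no norm on the
    -- data space is needed.
    refine (isCompact_Icc.prod isCompact_Icc).eventually_forall_of_forall_eventually fun q _ => ?_
    have e1 : Continuous fun w : (DataSpace × ℝ × ℝ) × ℝ × ℝ =>
        w.1.1.2.1.ext (max w.2.1 0, w.1.2.1 + w.2.1, w.2.2) :=
      continuous_ext_halfSpace (hmul.comp (by fun_prop)) (by fun_prop) (by fun_prop) (by fun_prop)
    have e2 : Continuous fun w : (DataSpace × ℝ × ℝ) × ℝ × ℝ =>
        x.2.1.ext (max w.2.1 0, c + w.2.1, w.2.2) :=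
      continuous_ext_halfSpace (μ := fun _ => x.2.1) continuous_const (by fun_prop) (by fun_prop)
        (by fun_prop)
    have e3 := (e1.sub e2).abs.tendsto ((x, c, t₀), q)
    rw [Pi.sub_apply, sub_self, abs_zero] at e3
    exact e3.eventually (gt_mem_nhds hδ0)
  have h3 : ∀ᶠ p : DataSpace × ℝ × ℝ in 𝓝 (x, c, t₀),
      |y (max p.2.2 0) - y (max t₀ 0)| < ε / 2 := by
    have : ContinuousAt (fun p : DataSpace × ℝ × ℝ => y (max p.2.2 0)) (x, c, t₀) :=
      ContinuousAt.comp (f := fun p : DataSpace × ℝ × ℝ => p.2.2) (x := (x, c, t₀)) hyc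
        (by fun_prop)
    exact Metric.tendsto_nhds.1 this _ (half_pos hε)
  have h4 : ∀ᶠ p : DataSpace × ℝ × ℝ in 𝓝 (x, c, t₀), max p.2.2 0 < T := by
    have : Continuous fun p : DataSpace × ℝ × ℝ => max p.2.2 0 := by fun_prop
    exact (this.tendsto _).eventually (gt_mem_nhds (by simp [hT]))
  filter_upwards [h1, h2, h3, h4] with p hp1 hp2 hp3 hp4
  have hpT : max p.2.2 0 ∈ Set.Icc 0 T := ⟨le_max_right _ _, hp4.le⟩
  have := abs_sub_le_of_perturbed_ode (f := fun t ξ => x.2.1.ext (t, c + t, ξ))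
    (g := fun t ξ => p.1.2.1.ext (t, p.2.1 + t, ξ)) (hode x c) (hode p.1 p.2.1) hL
    (fun t ht ξ hξ => by
      simpa [max_eq_left ht.1] using hp2 (t, ξ) ⟨ht, abs_le.1 (hR t ht ξ hξ)⟩)
    (by simpa [characteristicSolution_zero] using hp1.le) hL0 hδ0 (hδ1 ▸ min_le_left _ _) _ hpT
  have h5 : δ * Real.exp ((L + 1) * max p.2.2 0) ≤ ε / 2 := by
    refine le_trans ?_ (hδ1.le.trans (min_le_right _ _))
    gcongr
  change |characteristicSolution p.1 p.2.1 (max p.2.2 0) - y (max t₀ 0)| < ε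
  calc _ = |(characteristicSolution p.1 p.2.1 (max p.2.2 0) - y (max p.2.2 0)) +
        (y (max p.2.2 0) - y (max t₀ 0))| := by ring_nf
    _ ≤ _ := abs_add_le _ _
    _ < ε := by linarith

/-! ### The family of solutions -/

/-- The solutions of the initial value problem as a family with parameter `(y₀, φ)`. -/
noncomputable def solutionFamily (x : DataSpace) (t η : ℝ) : ℝ :=
  characteristicSolution x (η - max t 0) (max t 0)

theorem solutionFamily_along (x : DataSpace) (c : ℝ) {t : ℝ} (ht : 0 ≤ t) :
    solutionFamily x t (c + t) = characteristicSolution x c t := by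
  simp [solutionFamily, max_eq_left ht]

theorem contFamily_solutionFamily : ContFamily solutionFamily := by
  refine ⟨?_, fun x t η => by simp [solutionFamily]⟩
  exact continuous_characteristicSolution.comp (by fun_prop :
    Continuous fun p : DataSpace × ℝ × ℝ => (p.1, p.2.2 - max p.2.1 0, p.2.1))

theorem solutionFamily_zero (x : DataSpace) (η : ℝ) : solutionFamily x 0 η = x.1.1.ext η := by
  simp [solutionFamily, characteristicSolution_zero]

theorem hasDerivWithinAt_solutionFamily (x : DataSpace) (c : ℝ) {t : ℝ} (ht : 0 ≤ t) :
    HasDerivWithinAt (fun t => solutionFamily x t (c + t))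
      (x.2.1.ext (t, c + t, solutionFamily x t (c + t))) (Set.Ici 0) t := by
  rw [solutionFamily_along x c ht]
  exact (hasDerivWithinAt_characteristicSolution x c ht).congr_of_mem
    (fun s hs => solutionFamily_along x c hs) ht

theorem eq_solutionFamily (x : DataSpace) (c : ℝ) {z : ℝ → ℝ} (h0 : z 0 = x.1.1.ext c)
    (hz : ∀ t, 0 ≤ t → HasDerivWithinAt z (x.2.1.ext (t, c + t, z t)) (Set.Ici 0) t) {t : ℝ}
    (ht : 0 ≤ t) : z t = solutionFamily x t (c + t) :=
  eq_of_characteristic_ode x.2.1 c (T := t)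
    (fun s hs => (hasDerivWithinAt_solutionFamily x c hs.1).mono Set.Icc_subset_Ici_self)
    (fun s hs => (hz s hs.1).mono Set.Icc_subset_Ici_self)
    (by simp [solutionFamily_zero, h0]) (Set.right_mem_Icc.2 ht)

/-- By periodicity of `y₀` and `φ`, the solution on the characteristic through `c + 1` solves the
problem on the one through `c`; uniqueness concludes. -/
theorem solutionFamily_periodic (x : DataSpace) (t η : ℝ) :
    solutionFamily x t (η + 1) = solutionFamily x t η := by
  have h : ∀ t η, 0 ≤ t → solutionFamily x t (η + 1) = solutionFamily x t η := fun t η ht => by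
    have hz := eq_solutionFamily x (η - t) (z := fun s => solutionFamily x s ((η - t + 1) + s))
      (by
        have := x.1.2 (η - t)
        simpa [solutionFamily_zero] using this)
      (fun s hs => (hasDerivWithinAt_solutionFamily x (η - t + 1) hs).congr_deriv (by
        have := x.2.2.1 s (η - t + s) (solutionFamily x s (η - t + 1 + s))
        rw [← this]
        ring_nf)) ht
    simp only [sub_add_cancel] at hz
    rw [← hz]
    ring_nf
  rw [← contFamily_solutionFamily.2 x t, ← contFamily_solutionFamily.2 x t η]
  exact h _ _ (le_max_right _ _)

/-! ### Derivatives of the solution in the data, in `η` and in `t`. -/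

theorem transport_along {X : Type*} (f : X → ℝ → ℝ → ℝ) (x : X) (c : ℝ) {t : ℝ} (ht : 0 ≤ t) :
    transport f x t (c + t) = ∫ τ in (0 : ℝ)..t, f x τ (c + τ) := by
  simp [transport, max_eq_left ht]

theorem linearSolution_along {X : Type*} (β a α : X → ℝ → ℝ → ℝ) (x : X) (c : ℝ) {t : ℝ}
    (ht : 0 ≤ t) :
    linearSolution β a α x t (c + t) = Real.exp (∫ τ in (0 : ℝ)..t, β x τ (c + τ)) *
      (a x t (c + t) +
        ∫ τ in (0 : ℝ)..t, Real.exp (-∫ σ in (0 : ℝ)..τ, β x σ (c + σ)) * α x τ (c + τ)) := by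
  rw [linearSolution, transport_along _ _ _ ht, transport_along _ _ _ ht]
  congr 2
  refine intervalIntegral.integral_congr fun τ hτ => ?_
  rw [Set.uIcc_of_le ht] at hτ
  simp only [transport_along _ _ _ hτ.1]

/-- The initial value, as a continuous linear function of the data. -/
noncomputable def initialCLM : DataSpace →L[ℝ] SmoothSpace (Set.univ : Set ℝ) :=
  smoothCircle.subtypeL.comp (ContinuousLinearMap.fst ℝ _ _)

/-- The nonlinearity, as a continuous linear function of the data. -/
noncomputable def nonlinearityCLM : DataSpace →L[ℝ] SmoothSpace halfSpace :=
  nonlinearitySpace.subtypeL.comp (ContinuousLinearMap.snd ℝ _ _)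

/-- The derivative of the solutions in the data. -/
noncomputable def solutionFamilyX : DataSpace × DataSpace → ℝ → ℝ → ℝ :=
  linearSolution
    (fun p t η => (SmoothSpace.dirDeriv halfSpace (0, 0, 1) (nonlinearityCLM p.1)).ext
      (max t 0, η, solutionFamily p.1 t η))
    (fun p t η => (initialCLM p.2).ext (η - max t 0))
    (fun p t η => (nonlinearityCLM p.2).ext (max t 0, η, solutionFamily p.1 t η))

/-- The derivative of the solutions in `η`. -/
noncomputable def solutionFamilyη : DataSpace → ℝ → ℝ → ℝ :=
  linearSolution
    (fun x t η => (SmoothSpace.dirDeriv halfSpace (0, 0, 1) (nonlinearityCLM x)).ext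
      (max t 0, η, solutionFamily x t η))
    (fun x t η => (SmoothSpace.dirDeriv Set.univ 1 (initialCLM x)).ext (η - max t 0))
    (fun x t η => (SmoothSpace.dirDeriv halfSpace (0, 1, 0) (nonlinearityCLM x)).ext
      (max t 0, η, solutionFamily x t η))

/-- The formula contains the solution but none of its derivatives, so its regularity is that of the
solution. -/
theorem diffFamily_solutionFamilyX {n : ℕ} (h : DiffFamily n solutionFamily) :
    DiffFamily n solutionFamilyX :=
  DiffFamily.linearSolution
    (h.comp_fst.nemytskii (((SmoothSpace.dirDeriv halfSpace (0, 0, 1)).comp nonlinearityCLM).comp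
      (ContinuousLinearMap.fst ℝ DataSpace DataSpace)))
    (diffFamily_eval_univ (initialCLM.comp (ContinuousLinearMap.snd ℝ DataSpace DataSpace)))
    (h.comp_fst.nemytskii (nonlinearityCLM.comp (ContinuousLinearMap.snd ℝ DataSpace DataSpace)))

theorem diffFamily_solutionFamilyη {n : ℕ} (h : DiffFamily n solutionFamily) :
    DiffFamily n solutionFamilyη :=
  DiffFamily.linearSolution
    (h.nemytskii ((SmoothSpace.dirDeriv halfSpace (0, 0, 1)).comp nonlinearityCLM))
    (diffFamily_eval_univ ((SmoothSpace.dirDeriv Set.univ 1).comp initialCLM))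
    (h.nemytskii ((SmoothSpace.dirDeriv halfSpace (0, 1, 0)).comp nonlinearityCLM))

theorem hasDerivAt_solutionFamily_data (x u : DataSpace) (t η : ℝ) :
    HasDerivAt (fun s : ℝ => solutionFamily (x + s • u) t η) (solutionFamilyX (x, u) t η) 0 := by
  have h : ∀ t c, 0 ≤ t → HasDerivAt (fun s : ℝ => solutionFamily (x + s • u) t (c + t))
      (solutionFamilyX (x, u) t (c + t)) 0 := fun t c ht => by
    have hS := contFamily_solutionFamily
    have hadd : ∀ (s : ℝ) q, (x + s • u).2.1.ext q = x.2.1.ext q + s * u.2.1.ext q := fun s q => by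
      change (x.2.1 + s • u.2.1).ext q = _
      rw [SmoothSpace.ext_add, SmoothSpace.ext_smul]
      rfl
    have hadd' : ∀ (s : ℝ) q, (x + s • u).1.1.ext q = x.1.1.ext q + s * u.1.1.ext q := fun s q => by
      change (x.1.1 + s • u.1.1).ext q = _
      rw [SmoothSpace.ext_add, SmoothSpace.ext_smul]
      rfl
    have key := hasDerivAt_solution_of_parameter
      (Y := fun s τ => solutionFamily (x + s • u) τ (c + τ))
      (Φ := fun s τ ξ => (x + s • u).2.1.ext (max τ 0, c + τ, ξ))
      (Φs := fun _ τ ξ => u.2.1.ext (max τ 0, c + τ, ξ))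
      (Φξ := fun τ ξ => (SmoothSpace.dirDeriv halfSpace (0, 0, 1) x.2.1).ext (max τ 0, c + τ, ξ))
      (a' := u.1.1.ext c)
      (hS.continuous_comp (by fun_prop) (by fun_prop) (by fun_prop))
      (fun s τ hτ => by
        simpa only [max_eq_left hτ] using hasDerivWithinAt_solutionFamily (x + s • u) c hτ)
      (fun s τ ξ => by
        simp only [hadd]
        simpa using ((hasDerivAt_id s).mul_const (u.2.1.ext (max τ 0, c + τ, ξ))).const_add
          (x.2.1.ext (max τ 0, c + τ, ξ)))
      (fun τ ξ => by simpa using x.2.1.hasDerivAt_snd (le_max_right τ 0) (c + τ) ξ)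
      (continuous_ext_halfSpace (μ := fun _ => u.2.1) continuous_const (by fun_prop) (by fun_prop)
        (by fun_prop))
      (continuous_ext_halfSpace (μ := fun _ => SmoothSpace.dirDeriv halfSpace (0, 0, 1) x.2.1)
        continuous_const continuous_fst (by fun_prop) continuous_snd)
      (by
        simp only [solutionFamily_zero, add_zero, hadd']
        simpa using ((hasDerivAt_id (0 : ℝ)).mul_const (u.1.1.ext c)).const_add (x.1.1.ext c))
      ht
    refine key.congr_deriv ?_
    rw [solutionFamilyX, linearSolution_along _ _ _ _ _ ht]
    simp only [zero_smul, add_zero, max_eq_left ht, add_sub_cancel_right]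
    rfl
  -- From the characteristic coordinates `(t, c)` back to `(t, η)`, for every real `t`.
  have h1 := h (max t 0) (η - max t 0) (le_max_right _ _)
  simp only [sub_add_cancel, contFamily_solutionFamily.2] at h1
  rwa [(diffFamily_solutionFamilyX (n := 0) contFamily_solutionFamily).cont.2] at h1

theorem hasDerivAt_solutionFamily_space (x : DataSpace) (t η : ℝ) :
    HasDerivAt (solutionFamily x t) (solutionFamilyη x t η) η := by
  have h : ∀ t c, 0 ≤ t → HasDerivAt (fun s : ℝ => solutionFamily x t (c + s + t))
      (solutionFamilyη x t (c + t)) 0 := fun t c ht => by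
    have hS := contFamily_solutionFamily
    -- The parameter `s` shifts the starting point of the characteristic; at fixed `t` this is the
    -- same as a shift of `η`.
    have key := hasDerivAt_solution_of_parameter
      (Y := fun s τ => solutionFamily x τ (c + s + τ))
      (Φ := fun s τ ξ => x.2.1.ext (max τ 0, c + s + τ, ξ))
      (Φs := fun s τ ξ =>
        (SmoothSpace.dirDeriv halfSpace (0, 1, 0) x.2.1).ext (max τ 0, c + s + τ, ξ))
      (Φξ := fun τ ξ => (SmoothSpace.dirDeriv halfSpace (0, 0, 1) x.2.1).ext (max τ 0, c + τ, ξ))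
      (a' := (SmoothSpace.dirDeriv Set.univ 1 x.1.1).ext c)
      (hS.continuous_comp (by fun_prop) (by fun_prop) (by fun_prop))
      (fun s τ hτ => by
        simpa only [max_eq_left hτ] using hasDerivWithinAt_solutionFamily x (c + s) hτ)
      (fun s τ ξ => by
        have := x.2.1.hasDerivAt_fst (le_max_right τ 0) (c + s + τ) ξ
        have e : HasDerivAt (fun s : ℝ => c + s + τ) 1 s :=
          ((hasDerivAt_id s).const_add c).add_const τ
        simpa using! this.comp s e)
      (fun τ ξ => by simpa using x.2.1.hasDerivAt_snd (le_max_right τ 0) (c + τ) ξ)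
      (continuous_ext_halfSpace (μ := fun _ => SmoothSpace.dirDeriv halfSpace (0, 1, 0) x.2.1)
        continuous_const (by fun_prop) (by fun_prop) (by fun_prop))
      (continuous_ext_halfSpace (μ := fun _ => SmoothSpace.dirDeriv halfSpace (0, 0, 1) x.2.1)
        continuous_const continuous_fst (by fun_prop) continuous_snd)
      (by
        simp only [solutionFamily_zero, add_zero]
        have h1 := hasDerivAt_dirDeriv_univ x.1.1 (c + 0)
        rw [add_zero] at h1
        have h2 : HasDerivAt (fun s : ℝ => c + s) 1 0 := (hasDerivAt_id 0).const_add c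
        simpa using! HasDerivAt.comp_of_eq (0 : ℝ) h1 h2 (add_zero c).symm)
      ht
    refine key.congr_deriv ?_
    rw [solutionFamilyη, linearSolution_along _ _ _ _ _ ht]
    simp only [add_zero, max_eq_left ht, add_sub_cancel_right]
    rfl
  have h1 := h (max t 0) (η - max t 0) (le_max_right _ _)
  simp only [sub_add_cancel, contFamily_solutionFamily.2,
    (diffFamily_solutionFamilyη (n := 0) contFamily_solutionFamily).cont.2] at h1
  have h2 : HasDerivAt (fun r : ℝ => r - η) 1 η := (hasDerivAt_id η).sub_const η
  have h3 := HasDerivAt.comp_of_eq η h1 h2 (sub_self η).symm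
  rw [mul_one] at h3
  refine h3.congr_of_eventuallyEq (Filter.Eventually.of_forall fun r => ?_)
  simp only [Function.comp_apply]
  congr 1
  ring

/-- The derivatives of `y(r, c + r)` in `r` and in `c` are known; along `c = η - r` they combine to
`φ - y_η`. -/
theorem hasDerivWithinAt_solutionFamily_time (x : DataSpace) {t : ℝ} (η : ℝ) (ht : 0 ≤ t) :
    HasDerivWithinAt (fun r => solutionFamily x r η)
      (x.2.1.ext (max t 0, η, solutionFamily x t η) + -solutionFamilyη x t η) (Set.Ici 0) t := by
  have hη := (diffFamily_solutionFamilyη (n := 0) contFamily_solutionFamily).cont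
  have h1 := hasFDerivWithinAt_halfPlane_of_partial (t₀ := t) (η₀ := η - t)
    (F := fun r c => solutionFamily x r (c + r)) (F₂ := fun r c => solutionFamilyη x r (c + r))
    (hasDerivWithinAt_solutionFamily x (η - t) ht)
    (fun r c _ => (hasDerivAt_solutionFamily_space x r (c + r)).comp_add_const c r)
    (Continuous.continuousWithinAt
      (hη.continuous_comp continuous_const continuous_fst
        (continuous_snd.add continuous_fst)))
  have h2 : HasDerivWithinAt (fun r : ℝ => (r, η - r)) (1, -1) (Set.Ici 0) t :=
    ((hasDerivAt_id t).prodMk ((hasDerivAt_id t).const_sub η)).hasDerivWithinAt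
  have h3 := h1.comp_hasDerivWithinAt t h2 (fun r hr => mem_halfPlane hr)
  simp only [Function.comp_def, sub_add_cancel] at h3
  refine h3.congr_deriv ?_
  simp [max_eq_left ht]

/-- All three derivatives are expressed through the solution itself, so each class `n` yields class
`n + 1`. -/
theorem smoothFamily_solutionFamily : SmoothFamily solutionFamily := by
  intro n
  induction n with
  | zero => exact contFamily_solutionFamily
  | succ n ih =>
    exact contFamily_solutionFamily.succ hasDerivAt_solutionFamily_data
      (fun x t η ht => hasDerivWithinAt_solutionFamily_time x η ht)
      hasDerivAt_solutionFamily_space (diffFamily_solutionFamilyX ih)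
      ((ih.nemytskii nonlinearityCLM).add (diffFamily_solutionFamilyη ih).neg)
      (diffFamily_solutionFamilyη ih)

/-! ### The solution map -/

/-- The map assigning to `(y₀, φ)` the solution of the initial value problem. -/
noncomputable def solutionMap : DataSpace → smoothHalfCylinder :=
  RegularFamily.toMap smoothFamily_solutionFamily.regular solutionFamily_periodic

theorem solutionMap_eqOn (x : DataSpace) :
    Set.EqOn (extendZero (solutionMap x).1.toFun) (fun q => solutionFamily x q.1 q.2) halfPlane :=
  SmoothSpace.mk_ext _ _

theorem hasDerivWithinAt_characteristic {z : ℝ × ℝ → ℝ} (hz : ContDiffOn ℝ 1 z halfPlane)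
    (c : ℝ) {t : ℝ} (ht : 0 ≤ t) :
    HasDerivWithinAt (fun s => z (s, c + s))
      (fderivWithin ℝ z halfPlane (t, c + t) (1, 0) + fderivWithin ℝ z halfPlane (t, c + t) (0, 1))
      (Set.Ici 0) t := by
  have h1 := ((hz.differentiableOn (by simp)) _ (mem_halfPlane (η := c + t) ht)).hasFDerivWithinAt
  have h2 : HasDerivWithinAt (fun s : ℝ => (s, c + s)) ((1 : ℝ), (1 : ℝ)) (Set.Ici 0) t :=
    ((hasDerivAt_id t).prodMk ((hasDerivAt_id t).const_add c)).hasDerivWithinAt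
  have h4 : ((1 : ℝ), (0 : ℝ)) + (0, 1) = (1, 1) := by simp
  rw [← map_add, h4]
  exact h1.comp_hasDerivWithinAt t h2 (fun s hs => mem_halfPlane hs)

theorem mem_solutionRelation_solutionMap (x : DataSpace) :
    (x, (solutionMap x).1.toFun) ∈ solutionRelation := by
  have hc : ContDiffOn ℝ 1 (extendZero (solutionMap x).1.toFun) halfPlane :=
    (solutionMap x).1.contDiffOn_ext.of_le (by exact_mod_cast le_top)
  refine (mem_solutionRelation_iff _ _).2 ⟨⟨hc, (solutionMap x).2⟩, fun η => ?_, fun t η ht => ?_⟩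
  · rw [solutionMap_eqOn x (mem_halfPlane le_rfl)]
    exact solutionFamily_zero x η
  · have h1 := hasDerivWithinAt_characteristic hc (η - t) ht
    have h2 := (hasDerivWithinAt_solutionFamily x (η - t) ht).congr_of_mem
      (fun s hs => solutionMap_eqOn x (mem_halfPlane (η := η - t + s) hs)) ht
    have h3 := (uniqueDiffOn_Ici (0 : ℝ) t ht).eq_deriv _ h1 h2
    rw [sub_add_cancel] at h3
    rw [h3, solutionMap_eqOn x (mem_halfPlane ht)]

/-- A `C¹` solution restricts to a solution of the ordinary equation on every characteristic, where
uniqueness holds. -/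
theorem eq_solutionMap {x : DataSpace} {y : halfPlane → ℝ} (h : (x, y) ∈ solutionRelation) :
    y = (solutionMap x).1.toFun := by
  obtain ⟨⟨hc, -⟩, h0, h1⟩ := (mem_solutionRelation_iff _ _).1 h
  funext q
  obtain ⟨⟨t, η⟩, hq⟩ := q
  have ht : 0 ≤ t := hq.1
  have h2 := eq_solutionFamily x (η - t) (z := fun s => extendZero y (s, η - t + s))
    (by simpa using h0 (η - t))
    (fun s hs => by
      rw [← h1 s _ hs]
      exact hasDerivWithinAt_characteristic hc (η - t) hs) ht
  simp only [sub_add_cancel] at h2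
  rw [extendZero_apply y ⟨(t, η), hq⟩] at h2
  exact h2

theorem theorem5p6 :
    solutionRelation.dom = Set.univ ∧
    ∃ S : DataSpace → smoothHalfCylinder,
      (∀ (x : DataSpace) (y : halfPlane → ℝ),
        (x, y) ∈ solutionRelation ↔ y = (S x).1.toFun) ∧
      KellerSmoothOn S Set.univ := by
  refine ⟨Set.eq_univ_of_forall fun x => ⟨_, mem_solutionRelation_solutionMap x⟩, solutionMap,
    fun x y => ⟨eq_solutionMap, ?_⟩,
    SmoothFamily.kellerSmoothOn smoothFamily_solutionFamily solutionFamily_periodic⟩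
  rintro rfl
  exact mem_solutionRelation_solutionMap x
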